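/- Consider the Minkowski plane $\mathbb R^{1,1}=\mathbb R^2$ with metric $g=dx^2-dy^2$ and volume form $dx\wedge dy$. Let $(\tau,n)$ be a basis of one of the following types: * space-like: $g(\tau,\tau)=1$, $g(n,n)=-1$, $g(\tau,n)=0$, with $(\tau,n)$ positively oriented (e.g. $\tau=\partial_x$, $n=\partial_y$); * time-like: $g(\tau,\tau)=-1$, $g(n,n)=1$, $g(\tau,n)=0$, with $(n,\tau)$ positively oriented (e.g. $\tau=\partial_y$, $n=\partial_x$); * light-like: $g(\tau,\tau)=g(n,n)=0$ (e.g. $\tau=\tfrac12(\partial_y+\partial_x)$, $n=\tfrac12(\partial_y-\partial_x)$). Let $s_0<s_1$ and let $D=\{a\tau+sn : a\in\mathbb R,\ s_0\le s\le s_1\}$ be the corresponding strip; its two boundary lines are identified with $\Sigma=\mathbb R$ by the parameter $a$. Fix $\eta>0$. A field on $D$ is a function $\varphi\in C^\infty(D)$ (smooth up to the boundary) whose $k$-th derivatives are $O((x^2+y^2)^{-(\eta+k)/2})$ at infinity for $k=0,1,2,\dots$. For $m>0$ let $S_m$ be the space of $f\in C^\infty(\mathbb R)$ with $f^{(k)}(a)=O(|a|^{-(m+k)})$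 at infinity for all $k\ge 0$, with its Fréchet topology given by the seminorms $\sup_a(1+a^2)^{(m+k)/2}|f^{(k)}(a)|$. The pre-phase space of $\Sigma$ is $\tilde\Phi=S_\eta\times S_{\eta+1}\ni(\phi,\phi_n)$, with the presymplectic form $\tilde\omega=\delta\tilde\alpha$, $\tilde\alpha=\int_\Sigma\mu\,(\Gamma\phi_n+u(\phi))\,\delta\phi$, where $\Sigma$ is oriented by $\tau$ and $\Gamma=g^{-1}(n^*,n^*)$, $u=g^{-1}(n^*,\cdot)-\Gamma n$, $\mu=\iota_n(dx\wedge dy)$, $n^*$ being the covector with $n^*(n)=1$, $n^*(\tau)=0$. The phase space is $\Phi=\tilde\Phi/\ker\tilde\omega$ with the induced symplectic form $\omega$. The phase space of $\partial D$ is $\bar\Phi\times\Phi$ with the form $(-\omega)\oplus\omega$, the factors belonging to $s=s_0$ and $s=s_1$. The evolution relation $L_D\subset\bar\Phi\times\Phi$ is the set of pairs of classes of the boundary values $(\varphi,\partial_n\varphi)|_{s=s_0}$, $(\varphi,\partial_n\varphi)|_{s=s_1}$ of all fields $\varphi$ on $D$ with $\partial_x^2\varphi-\partial_y^2\varphi=0$.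 A subset $L$ is called Lagrangian if it coincides with its orthogonal complement with respect to the form. Then: 1. If $(\tau,n)$ is space-like or time-like, then $\ker\tilde\omega=0$, so $\Phi=\tilde\Phi$; the relation $L_D$ is Lagrangian; and the Hamiltonian $H(\phi,\pi)=\frac12\int_{\mathbb R}(\pi^2+(\partial_a\phi)^2)\,da$, $\pi=\phi_n$, has a Hamiltonian vector field $X$ on $(\tilde\Phi,\tilde\omega)$ (that is, $\iota_X\tilde\omega=-\delta H$) which integrates to a flow $(U_t)_{t\in\mathbb R}$ on $\tilde\Phi$, differentiable in $t$ in the Fréchet topology, such that $L_D$ is the graph of $U_{s_1-s_0}$. 2. If $(\tau,n)$ is light-like, then $\ker\tilde\omega=\{\phi=0\}$, so that $\Phi$ is the space of the boundary values $\phi$ alone; and $L_D$ is the diagonal of $\bar\Phi\times\Phi$, which is Lagrangian. -/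

import Mathlib

open scoped ContDiff Topology

noncomputable section

namespace MinkowskiStrip

/-! ### The Minkowski plane: linear algebra

Points and vectors of the plane are pairs `(x, y)`; the metric is `dx² - dy²`. -/

/-- The Minkowski metric `dx² - dy²`. -/
def mink (v w : ℝ × ℝ) : ℝ := v.1 * w.1 - v.2 * w.2

/-- The metric volume element `dx ∧ dy`. -/
def area (v w : ℝ × ℝ) : ℝ := v.1 * w.2 - v.2 * w.1

/-- The covector `n*` with `n*(n) = 1` and `n*(τ) = 0`. -/
def conormal (τ n v : ℝ × ℝ) : ℝ := area τ v / area τ n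

/-- The vector `g⁻¹(n*, ·)`, i.e. the vector `N` with `mink N v = n*(v)` for all `v`. -/
def raisedConormal (τ n : ℝ × ℝ) : ℝ × ℝ := (conormal τ n (1, 0), -conormal τ n (0, 1))

/-- The boundary function `Γ = g⁻¹(n*, n*)`. -/
def bdryGamma (τ n : ℝ × ℝ) : ℝ := conormal τ n (raisedConormal τ n)

/-- The boundary vector field `u = g⁻¹(n*, ·) - Γ n`, which is tangent to the boundary line:
this is its coefficient with respect to `τ`, so that `u(f) = bdryDrift τ n * f'`
for functions of the parameter `a` of the line `a ↦ a τ + s n`. -/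
def bdryDrift (τ n : ℝ × ℝ) : ℝ :=
  conormal n τ (raisedConormal τ n - bdryGamma τ n • n)

/-- The boundary volume form `μ = ι_n (dx ∧ dy)` is `bdryDensity τ n * da`. -/
def bdryDensity (τ n : ℝ × ℝ) : ℝ := area n τ

/-- `τ` is a unit space-like vector and `n` a unit vector orthogonal to it, with `(τ, n)`
positively oriented, as for `(∂_x, ∂_y)`. -/
structure IsSpacelikeFrame (τ n : ℝ × ℝ) : Prop where
  tangent : mink τ τ = 1
  normal : mink n n = -1
  orthogonal : mink τ n = 0
  oriented : 0 < area τ n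

/-- `τ` is a unit time-like vector and `n` a unit vector orthogonal to it, with `(n, τ)`
positively oriented, as for `τ = ∂_y`, `n = ∂_x`. -/
structure IsTimelikeFrame (τ n : ℝ × ℝ) : Prop where
  tangent : mink τ τ = -1
  normal : mink n n = 1
  orthogonal : mink τ n = 0
  oriented : 0 < area n τ

/-- `τ` and `n` are linearly independent light-like vectors, as for
`τ = (∂_y + ∂_x) / 2`, `n = (∂_y - ∂_x) / 2`. -/
structure IsLightlikeFrame (τ n : ℝ × ℝ) : Prop where
  tangent : mink τ τ = 0
  normal : mink n n = 0
  independent : area τ n ≠ 0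

/-! ### Fields on a strip -/

/-- The strip `{a τ + s n : a ∈ ℝ, s₀ ≤ s ≤ s₁}`. -/
def strip (τ n : ℝ × ℝ) (s₀ s₁ : ℝ) : Set (ℝ × ℝ) :=
  {p | ∃ a s : ℝ, s ∈ Set.Icc s₀ s₁ ∧ p = a • τ + s • n}

/-- Fields on a closed domain `D`: functions smooth up to the boundary whose `k`-th derivatives
are `O((x² + y²)^(-(η + k)/2))` at infinity. (As `D` is closed and the derivatives are continuous
on `D`, the `O` at infinity is the same as the bound on all of `D` with `1 + x² + y²`.) -/
structure IsField (η : ℝ) (D : Set (ℝ × ℝ)) (φ : ℝ × ℝ → ℝ) : Prop where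
  smooth : ContDiffOn ℝ ∞ φ D
  decay : ∀ k : ℕ, ∃ C : ℝ, ∀ p ∈ D,
    ‖iteratedFDerivWithin ℝ k φ D p‖ ≤ C * (1 + p.1 ^ 2 + p.2 ^ 2) ^ (-(η + k) / 2)

/-- The Euler-Lagrange equation `∂_x² φ - ∂_y² φ = 0` on `D`. -/
def SolvesWaveEquation (D : Set (ℝ × ℝ)) (φ : ℝ × ℝ → ℝ) : Prop :=
  ∀ p ∈ D, iteratedFDerivWithin ℝ 2 φ D p (fun _ => ((1, 0) : ℝ × ℝ))
    - iteratedFDerivWithin ℝ 2 φ D p (fun _ => ((0, 1) : ℝ × ℝ)) = 0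

/-! ### The pre-phase space of a boundary line -/

/-- Smooth functions on the line with `f⁽ᵏ⁾ = O(|a|^(-(m + k)))` at infinity for all `k`. -/
def decaySpace (m : ℝ) : Submodule ℝ (ℝ → ℝ) where
  carrier := {f | ContDiff ℝ ∞ f ∧ ∀ k : ℕ, ∃ C : ℝ, ∀ a : ℝ,
    |iteratedDeriv k f a| ≤ C * (1 + a ^ 2) ^ (-(m + k) / 2)}
  zero_mem' := by
    refine ⟨contDiff_const, fun k => ⟨0, fun a => ?_⟩⟩
    simp
  add_mem' := by
    rintro f g ⟨hf, hf'⟩ ⟨hg, hg'⟩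
    refine ⟨hf.add hg, fun k => ?_⟩
    obtain ⟨C, hC⟩ := hf' k
    obtain ⟨C', hC'⟩ := hg' k
    refine ⟨C + C', fun a => ?_⟩
    rw [iteratedDeriv_add (hf.of_le (by exact_mod_cast le_top)).contDiffAt
      (hg.of_le (by exact_mod_cast le_top)).contDiffAt, add_mul]
    exact (abs_add_le _ _).trans (add_le_add (hC a) (hC' a))
  smul_mem' := by
    rintro c f ⟨hf, hf'⟩
    refine ⟨contDiff_const.smul hf, fun k => ?_⟩
    obtain ⟨C, hC⟩ := hf' k
    refine ⟨|c| * C, fun a => ?_⟩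
    have h : iteratedDeriv k (c • f) a = c * iteratedDeriv k f a := by
      rw [iteratedDeriv_const_smul (hf.of_le (by exact_mod_cast le_top)).contDiffAt, smul_eq_mul]
    rw [h, abs_mul, mul_assoc]
    exact mul_le_mul_of_nonneg_left (hC a) (abs_nonneg c)

/-- The pre-phase space of a line: pairs `(φ, φ_n)` (boundary value and transversal derivative)
with the asymptotics that the fields induce; `φ_n` is a first derivative of a field. -/
abbrev PrePhase (η : ℝ) : Type := decaySpace η × decaySpace (η + 1)

theorem integrable_mul_of_decay {r s : ℝ} (hrs : 1 < r + s) {f g : ℝ → ℝ}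
    (hf : Continuous f) (hg : Continuous g)
    (hf' : ∃ C : ℝ, ∀ a : ℝ, |f a| ≤ C * (1 + a ^ 2) ^ (-r / 2))
    (hg' : ∃ C : ℝ, ∀ a : ℝ, |g a| ≤ C * (1 + a ^ 2) ^ (-s / 2)) :
    MeasureTheory.Integrable (fun a => f a * g a) := by
  obtain ⟨C, hC⟩ := hf'
  obtain ⟨C', hC'⟩ := hg'
  have h1 : MeasureTheory.Integrable
      (fun a : ℝ => C * C' * (1 + a ^ 2) ^ (-(r + s) / 2)) := by
    have := integrable_rpow_neg_one_add_norm_sq (E := ℝ) (μ := MeasureTheory.volume)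
      (r := r + s) (by simpa using hrs)
    simpa using this.const_mul (C * C')
  refine h1.mono' (hf.mul hg).aestronglyMeasurable (Filter.Eventually.of_forall fun a => ?_)
  have hpos : (0 : ℝ) < 1 + a ^ 2 := by positivity
  rw [Real.norm_eq_abs, abs_mul]
  calc |f a| * |g a| ≤ (C * (1 + a ^ 2) ^ (-r / 2)) * (C' * (1 + a ^ 2) ^ (-s / 2)) :=
        mul_le_mul (hC a) (hC' a) (abs_nonneg _) ((abs_nonneg _).trans (hC a))
    _ = C * C' * (1 + a ^ 2) ^ (-(r + s) / 2) := by
        rw [show -(r + s) / 2 = -r / 2 + -s / 2 by ring, Real.rpow_add hpos]; ring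

theorem differentiable_of_mem {m : ℝ} (f : decaySpace m) : Differentiable ℝ (f : ℝ → ℝ) :=
  f.2.1.differentiable (by simp)

theorem integrable_deriv_mul {η : ℝ} (hη : 0 < η) (f g : decaySpace η) :
    MeasureTheory.Integrable (fun a => deriv (f : ℝ → ℝ) a * (g : ℝ → ℝ) a) := by
  refine integrable_mul_of_decay (r := η + 1) (s := η) (by linarith)
    (f.2.1.continuous_deriv (by simp)) g.2.1.continuous ?_ ?_
  · simpa [iteratedDeriv_one] using f.2.2 1
  · simpa using g.2.2 0

theorem integrable_mul {η : ℝ} (hη : 0 < η) (f : decaySpace (η + 1)) (g : decaySpace η) :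
    MeasureTheory.Integrable (fun a => (f : ℝ → ℝ) a * (g : ℝ → ℝ) a) := by
  refine integrable_mul_of_decay (r := η + 1) (s := η) (by linarith)
    f.2.1.continuous g.2.1.continuous ?_ ?_
  · simpa using f.2.2 0
  · simpa using g.2.2 0

theorem integrable_alpha {η : ℝ} (hη : 0 < η) (c d : ℝ) (p q : PrePhase η) :
    MeasureTheory.Integrable (fun a : ℝ =>
      (c * (p.2 : ℝ → ℝ) a + d * deriv (p.1 : ℝ → ℝ) a) * (q.1 : ℝ → ℝ) a) := by
  refine (((integrable_mul hη p.2 q.1).const_mul c).add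
    ((integrable_deriv_mul hη p.1 q.1).const_mul d)).congr
    (Filter.Eventually.of_forall fun a => ?_)
  simp only [Pi.add_apply]
  ring

/-- The 1-form `α̃ = ∫ μ (Γ φ_n + u(φ)) δφ` on the pre-phase space: its value at the point `p` on
the tangent vector `q`. The line is oriented by `τ`. -/
def alphaForm (η : ℝ) (hη : 0 < η) (τ n : ℝ × ℝ) : PrePhase η →ₗ[ℝ] PrePhase η →ₗ[ℝ] ℝ :=
  LinearMap.mk₂ ℝ
    (fun p q => bdryDensity τ n * ∫ a : ℝ,
      (bdryGamma τ n * (p.2 : ℝ → ℝ) a + bdryDrift τ n * deriv (p.1 : ℝ → ℝ) a)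
        * (q.1 : ℝ → ℝ) a)
    (by
      intro p p' q
      rw [← mul_add, ← MeasureTheory.integral_add (integrable_alpha hη _ _ p q)
        (integrable_alpha hη _ _ p' q)]
      congr 2
      funext a
      have h : deriv (((p + p').1 : decaySpace η) : ℝ → ℝ) a
          = deriv (p.1 : ℝ → ℝ) a + deriv (p'.1 : ℝ → ℝ) a :=
        deriv_add (differentiable_of_mem p.1 a) (differentiable_of_mem p'.1 a)
      rw [h]
      simp only [Prod.snd_add, Submodule.coe_add, Pi.add_apply]
      ring)
    (by
      intro c p q
      rw [smul_eq_mul, mul_left_comm, ← MeasureTheory.integral_const_mul c]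
      congr 2
      funext a
      have h : deriv (((c • p).1 : decaySpace η) : ℝ → ℝ) a = c * deriv (p.1 : ℝ → ℝ) a :=
        deriv_const_mul c (differentiable_of_mem p.1 a)
      rw [h]
      simp only [Prod.smul_snd, Submodule.coe_smul, Pi.smul_apply, smul_eq_mul]
      ring)
    (by
      intro p q q'
      rw [← mul_add, ← MeasureTheory.integral_add (integrable_alpha hη _ _ p q)
        (integrable_alpha hη _ _ p q')]
      congr 2
      funext a
      simp only [Prod.fst_add, Submodule.coe_add, Pi.add_apply]
      ring)
    (by
      intro c p q
      rw [smul_eq_mul, mul_left_comm, ← MeasureTheory.integral_const_mul c]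
      congr 2
      funext a
      simp only [Prod.smul_fst, Submodule.coe_smul, Pi.smul_apply, smul_eq_mul]
      ring)

/-- The presymplectic form `ω̃ = δα̃` on the pre-phase space. -/
def preForm (η : ℝ) (hη : 0 < η) (τ n : ℝ × ℝ) : PrePhase η →ₗ[ℝ] PrePhase η →ₗ[ℝ] ℝ :=
  alphaForm η hη τ n - (alphaForm η hη τ n).flip

/-! ### The phase space -/

/-- The phase space of a line: the pre-phase space modulo the kernel of `ω̃`. -/
abbrev Phase (η : ℝ) (hη : 0 < η) (τ n : ℝ × ℝ) : Type :=
  PrePhase η ⧸ LinearMap.ker (preForm η hη τ n)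

/-- The projection from the pre-phase space to the phase space. -/
def toPhase (η : ℝ) (hη : 0 < η) (τ n : ℝ × ℝ) : PrePhase η →ₗ[ℝ] Phase η hη τ n :=
  (LinearMap.ker (preForm η hη τ n)).mkQ

theorem ker_le_ker_flip (η : ℝ) (hη : 0 < η) (τ n : ℝ × ℝ) :
    LinearMap.ker (preForm η hη τ n) ≤ LinearMap.ker
      ((LinearMap.ker (preForm η hη τ n)).liftQ (preForm η hη τ n) le_rfl).flip := by
  intro p hp
  rw [LinearMap.mem_ker] at hp ⊢
  refine LinearMap.ext fun x => ?_
  obtain ⟨q, rfl⟩ := Submodule.mkQ_surjective _ x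
  have h : preForm η hη τ n p q = 0 := by rw [hp]; rfl
  change preForm η hη τ n q p = 0
  simp only [preForm, LinearMap.sub_apply, LinearMap.flip_apply] at h ⊢
  linarith

/-- The symplectic form `ω` on the phase space, to which `ω̃` descends. -/
def phaseForm (η : ℝ) (hη : 0 < η) (τ n : ℝ × ℝ) :
    Phase η hη τ n →ₗ[ℝ] Phase η hη τ n →ₗ[ℝ] ℝ :=
  ((LinearMap.ker (preForm η hη τ n)).liftQ
    ((LinearMap.ker (preForm η hη τ n)).liftQ (preForm η hη τ n) le_rfl).flip
    (ker_le_ker_flip η hη τ n)).flip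

theorem phaseForm_toPhase (η : ℝ) (hη : 0 < η) (τ n : ℝ × ℝ) (p q : PrePhase η) :
    phaseForm η hη τ n (toPhase η hη τ n p) (toPhase η hη τ n q) = preForm η hη τ n p q := rfl

/-- The phase space of the boundary of the strip is `Φ̄ × Φ`; its symplectic form is `-ω` on the
first factor (the component `s = s₀`) plus `ω` on the second one (the component `s = s₁`). -/
def stripForm (η : ℝ) (hη : 0 < η) (τ n : ℝ × ℝ)
    (z w : Phase η hη τ n × Phase η hη τ n) : ℝ :=
  phaseForm η hη τ n z.2 w.2 - phaseForm η hη τ n z.1 w.1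

/-- A subset is Lagrangian if it equals its own orthogonal with respect to the form `Ω`
(that is, it is an isotropic and coisotropic subspace). -/
def IsLagrangian {V : Type*} (Ω : V → V → ℝ) (L : Set V) : Prop :=
  L = {z | ∀ w ∈ L, Ω z w = 0}

/-! ### The evolution relation -/

/-- `p` is the boundary value `(φ, ∂_n φ)` of the field `φ` on the line `a ↦ a τ + s n`. -/
def IsBoundaryValue {η : ℝ} (D : Set (ℝ × ℝ)) (τ n : ℝ × ℝ) (s : ℝ) (φ : ℝ × ℝ → ℝ)
    (p : PrePhase η) : Prop :=
  ∀ a : ℝ, (p.1 : ℝ → ℝ) a = φ (a • τ + s • n) ∧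
    (p.2 : ℝ → ℝ) a = fderivWithin ℝ φ D (a • τ + s • n) n

/-- The evolution relation `L_D ⊆ Φ̄ × Φ`: the boundary values, projected to the phase space,
of the fields on the strip that solve the Euler-Lagrange equation. -/
def evolutionRelation (η : ℝ) (hη : 0 < η) (τ n : ℝ × ℝ) (s₀ s₁ : ℝ) :
    Set (Phase η hη τ n × Phase η hη τ n) :=
  {z | ∃ φ : ℝ × ℝ → ℝ, IsField η (strip τ n s₀ s₁) φ ∧
    SolvesWaveEquation (strip τ n s₀ s₁) φ ∧
    ∃ p₀ p₁ : PrePhase η, IsBoundaryValue (strip τ n s₀ s₁) τ n s₀ φ p₀ ∧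
      IsBoundaryValue (strip τ n s₀ s₁) τ n s₁ φ p₁ ∧
      z = (toPhase η hη τ n p₀, toPhase η hη τ n p₁)}

/-! ### Hamiltonian flows -/

/-- The Hamiltonian `H = ½ ∫ (π² + (∂φ)²)`, where `π = φ_n` and `∂` is the derivative
along the line. -/
def hamiltonian {η : ℝ} (p : PrePhase η) : ℝ :=
  1 / 2 * ∫ a : ℝ, (((p.2 : ℝ → ℝ) a) ^ 2 + (deriv (p.1 : ℝ → ℝ) a) ^ 2)

/-- `X` is the Hamiltonian vector field of `H`: `ι_X Ω = -δH`, that is, `δH(w) = Ω(w, X)`. (With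
`Ω = ∫ δπ ∧ δφ` these are Hamilton's equations `φ' = δH/δπ`, `π' = -δH/δφ`.) -/
def IsHamiltonianVectorField {V : Type*} [AddCommGroup V] [Module ℝ V]
    (Ω : V →ₗ[ℝ] V →ₗ[ℝ] ℝ) (H : V → ℝ) (X : V → V) : Prop :=
  ∀ p w : V, HasDerivAt (fun t : ℝ => H (p + t • w)) (Ω w (X p)) 0

/-- The curve `c` in the pre-phase space has derivative `v` at time `t`, in the Fréchet topology
given by the seminorms `sup_a (1 + a²)^((m + k)/2) |f⁽ᵏ⁾(a)|` of the two factors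
(`m = η` and `m = η + 1`). -/
def HasFrechetDerivAt {η : ℝ} (c : ℝ → PrePhase η) (v : PrePhase η) (t : ℝ) : Prop :=
  ∀ k : ℕ, ∀ ε > 0, ∀ᶠ h in 𝓝[≠] (0 : ℝ), ∀ a : ℝ,
    |iteratedDeriv k ((h⁻¹ • (c (t + h) - c t) - v).1 : ℝ → ℝ) a|
        ≤ ε * (1 + a ^ 2) ^ (-(η + k) / 2) ∧
      |iteratedDeriv k ((h⁻¹ • (c (t + h) - c t) - v).2 : ℝ → ℝ) a|
        ≤ ε * (1 + a ^ 2) ^ (-(η + 1 + k) / 2)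

/-- `U` is the (globally defined) flow of the Hamiltonian vector field of `H`. -/
def IsHamiltonianFlow {η : ℝ} (Ω : PrePhase η →ₗ[ℝ] PrePhase η →ₗ[ℝ] ℝ)
    (H : PrePhase η → ℝ) (U : ℝ → PrePhase η → PrePhase η) : Prop :=
  ∃ X : PrePhase η → PrePhase η, IsHamiltonianVectorField Ω H X ∧
    (∀ p, U 0 p = p) ∧ (∀ s t p, U (s + t) p = U s (U t p)) ∧
    ∀ t p, HasFrechetDerivAt (fun s => U s p) (X (U t p)) t

end MinkowskiStrip

end

open scoped ContDiff Topology

noncomputable section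

namespace MinkowskiStrip

/-! ### Weights and decaying functions -/

/-! For a space-like or time-like frame, orthonormality and orientation force `n` to be `τ` with its
components swapped. Then `μΓ = da` and `u = 0`, so `ω̃` is the canonical form `∫ (π_p φ_q - π_q
φ_p)`, which compactly supported test functions show to be nondegenerate. The directions `n ± τ` are
null, so the flow is d'Alembert's `F(a + s) + G(a - s)` with `F, G = (φ ± ∫ φ_n)/2`.

The analytic difficulty is that the primitive of `φ_n` tends to constants at `±∞` that need not
vanish, so `F` and `G` need not decay separately. Their derivatives and their sum do (`IsWavePair`),
and by the mean value inequality this suffices to bound `F(a + t) + G(a - t)` with weights, and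
likewise the fields on the strip and the difference quotients of the flow.

That each solution follows the flow (`eq_waveFlow_of_isBoundaryValue`) comes from characteristics:
the mixed null derivative of a solution vanishes, so `∂_{n+τ} φ` is transported along `n - τ` and
vice versa; decay fixes the constant of integration. The flow preserves `ω̃` because `∂²` is
symmetric (`preForm_waveFlow`), and the graph of an invertible symplectic map is Lagrangian.

For a light-like frame `Γ = 0` and `ω̃` is a nonzero multiple of `∫ φ_p' φ_q`, which ignores `φ_n`
and whose kernel is `φ = 0`. The wave equation reads `∂_n ∂_τ φ = 0`, so `∂_τ φ`, and by decay `φ`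
itself, agrees on both lines; conversely each `φ` extends constantly along `n`. The diagonal is
Lagrangian since `ω` is nondegenerate on the quotient. -/

theorem rpow_neg_le_of_le_mul {r K A B : ℝ} (hr : 0 ≤ r) (hK : 0 < K) (hA : 0 < A)
    (h : A ≤ K * B) : B ^ (-r / 2) ≤ K ^ (r / 2) * A ^ (-r / 2) := by
  have h1 : A / K ≤ B := by rw [div_le_iff₀ hK]; linarith
  calc B ^ (-r / 2) ≤ (A / K) ^ (-r / 2) :=
        Real.rpow_le_rpow_of_nonpos (div_pos hA hK) h1 (by linarith)
    _ = K ^ (r / 2) * A ^ (-r / 2) := by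
        rw [Real.div_rpow hA.le hK.le, show -r / 2 = -(r / 2) by ring, Real.rpow_neg hK.le,
          div_inv_eq_mul, mul_comm]

/-- Weights at points of bounded distance are comparable, so a bounded shift of the argument costs
only a constant factor. -/
theorem one_add_sq_le {a x T : ℝ} (h : |x - a| ≤ T) :
    1 + a ^ 2 ≤ 2 * (1 + T ^ 2) * (1 + x ^ 2) := by
  have h1 : (x - a) ^ 2 ≤ T ^ 2 := sq_le_sq' (by linarith [abs_le.1 h]) (abs_le.1 h).2
  nlinarith [sq_nonneg (2 * x - a), mul_nonneg (sq_nonneg T) (sq_nonneg x)]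

theorem weight_pos (r a : ℝ) : 0 < (1 + a ^ 2) ^ r := by positivity

theorem weight_anti {r r' a : ℝ} (h : r ≤ r') :
    (1 + a ^ 2) ^ (-r' / 2) ≤ (1 + a ^ 2) ^ (-r / 2) :=
  Real.rpow_le_rpow_of_exponent_le (by nlinarith [sq_nonneg a]) (by linarith)

/-- A decay bound holds uniformly for all points at bounded distance. -/
theorem exists_bound_near {f : ℝ → ℝ} {r : ℝ} (hr : 0 ≤ r)
    (hf : ∃ C : ℝ, ∀ a : ℝ, |f a| ≤ C * (1 + a ^ 2) ^ (-r / 2)) (T : ℝ) :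
    ∃ C : ℝ, 0 ≤ C ∧ ∀ a x : ℝ, |x - a| ≤ T → |f x| ≤ C * (1 + a ^ 2) ^ (-r / 2) := by
  obtain ⟨C, hC⟩ := hf
  have hC0 : 0 ≤ C := by
    have := (abs_nonneg _).trans (hC 0)
    simpa using this
  have hK : 0 < 2 * (1 + T ^ 2) := by positivity
  refine ⟨C * (2 * (1 + T ^ 2)) ^ (r / 2), by positivity, fun a x h => (hC x).trans ?_⟩
  rw [mul_assoc]
  exact mul_le_mul_of_nonneg_left
    (rpow_neg_le_of_le_mul hr hK (by positivity) (one_add_sq_le h)) hC0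

theorem contDiff_deriv_of_smooth {f : ℝ → ℝ} (hf : ContDiff ℝ ∞ f) : ContDiff ℝ ∞ (deriv f) :=
  (contDiff_infty_iff_deriv.1 hf).2

theorem contDiffAt_nat_of_smooth {f : ℝ → ℝ} (hf : ContDiff ℝ ∞ f) (k : ℕ) (a : ℝ) :
    ContDiffAt ℝ k f a :=
  (hf.of_le (by exact_mod_cast le_top)).contDiffAt

theorem deriv_mem_decaySpace {m : ℝ} {f : ℝ → ℝ} (hf : f ∈ decaySpace m) :
    deriv f ∈ decaySpace (m + 1) := by
  refine ⟨contDiff_deriv_of_smooth hf.1, fun k => ?_⟩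
  obtain ⟨C, hC⟩ := hf.2 (k + 1)
  refine ⟨C, fun a => ?_⟩
  have := hC a
  rw [iteratedDeriv_succ'] at this
  convert this using 3
  push_cast; ring

theorem continuous_of_mem {m : ℝ} {f : ℝ → ℝ} (hf : f ∈ decaySpace m) : Continuous f :=
  hf.1.continuous

theorem bound_of_mem {m : ℝ} {f : ℝ → ℝ} (hf : f ∈ decaySpace m) :
    ∃ C : ℝ, ∀ a : ℝ, |f a| ≤ C * (1 + a ^ 2) ^ (-m / 2) := by
  simpa using hf.2 0

theorem integrable_mul_of_mem {m m' : ℝ} (h : 1 < m + m') {f g : ℝ → ℝ}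
    (hf : f ∈ decaySpace m) (hg : g ∈ decaySpace m') :
    MeasureTheory.Integrable (fun a => f a * g a) :=
  integrable_mul_of_decay h (continuous_of_mem hf) (continuous_of_mem hg)
    (bound_of_mem hf) (bound_of_mem hg)

/-- A filter along which `a ^ 2` tends to infinity covers both ends of the line at once. -/
theorem tendsto_zero_of_mem {m : ℝ} (hm : 0 < m) {f : ℝ → ℝ} (hf : f ∈ decaySpace m)
    {l : Filter ℝ} (hl : Filter.Tendsto (fun a : ℝ => a ^ 2) l Filter.atTop) :
    Filter.Tendsto f l (𝓝 0) := by
  obtain ⟨C, hC⟩ := bound_of_mem hf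
  refine squeeze_zero_norm hC ?_
  have h1 : Filter.Tendsto (fun a : ℝ => 1 + a ^ 2) l Filter.atTop :=
    Filter.tendsto_atTop_add_const_left _ _ hl
  have h2 := (tendsto_rpow_neg_atTop (y := m / 2) (by linarith)).comp h1
  have h3 := h2.const_mul C
  simp only [mul_zero] at h3
  refine h3.congr fun a => ?_
  simp only [Function.comp]
  rw [neg_div]

/-- Decay of positive order kills the constant of integration; this is how boundary values are
recovered from their tangential derivatives. -/
theorem eq_zero_of_deriv_eq_zero {m : ℝ} (hm : 0 < m) {f : ℝ → ℝ} (hf : f ∈ decaySpace m)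
    (h : ∀ a, deriv f a = 0) : f = 0 := by
  have hconst := is_const_of_deriv_eq_zero (hf.1.differentiable (by simp)) h
  funext a
  have h1 : Filter.Tendsto (fun _ : ℝ => f a) Filter.atTop (𝓝 0) :=
    (tendsto_zero_of_mem hm hf (Filter.tendsto_pow_atTop two_ne_zero)).congr fun x => hconst x a
  exact tendsto_nhds_unique tendsto_const_nhds h1

theorem eq_of_deriv_eq {m : ℝ} (hm : 0 < m) {f g : ℝ → ℝ} (hf : f ∈ decaySpace m)
    (hg : g ∈ decaySpace m) (h : ∀ a, deriv f a = deriv g a) : f = g := by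
  have h1 : f - g = 0 := eq_zero_of_deriv_eq_zero hm ((decaySpace m).sub_mem hf hg) fun a => by
    rw [deriv_sub (hf.1.differentiable (by simp) a) (hg.1.differentiable (by simp) a), h, sub_self]
  exact sub_eq_zero.1 h1

/-- Supplies the test functions for computing the kernel of `ω̃`: the weighted derivative is
continuous with compact support, hence bounded. -/
theorem mem_decaySpace_of_hasCompactSupport (m : ℝ) {g : ℝ → ℝ} (hg : ContDiff ℝ ∞ g)
    (hc : HasCompactSupport g) : g ∈ decaySpace m := by
  refine ⟨hg, fun k => ?_⟩
  have hcont : Continuous (iteratedDeriv k g) :=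
    hg.continuous_iteratedDeriv k (by exact_mod_cast le_top)
  have hsupp : HasCompactSupport (iteratedDeriv k g) := by
    have h := hc.iteratedFDeriv (𝕜 := ℝ) k
    rw [hasCompactSupport_iff_eventuallyEq] at h ⊢
    filter_upwards [h] with x hx
    rw [iteratedDeriv_eq_iteratedFDeriv, hx]
    simp
  have hw : Continuous fun a : ℝ => (1 + a ^ 2) ^ ((m + k) / 2) :=
    Continuous.rpow_const (by fun_prop) fun a => Or.inl (by positivity)
  obtain ⟨C, hC⟩ := (hsupp.mul_right (f' := fun a : ℝ => (1 + a ^ 2) ^ ((m + k) / 2))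
    ).exists_bound_of_continuous (hcont.mul hw)
  refine ⟨C, fun a => ?_⟩
  have h1 := hC a
  simp only [Pi.mul_apply, norm_mul, Real.norm_eq_abs, abs_of_pos (weight_pos _ a)] at h1
  rw [neg_div, Real.rpow_neg (by positivity), ← div_eq_mul_inv, le_div_iff₀ (weight_pos _ a)]
  exact h1

/-! ### Superpositions of travelling waves -/

/-- The wave `F(a + t) + G(a - t)` at time `t`. -/
def wave (F G : ℝ → ℝ) (t a : ℝ) : ℝ := F (a + t) + G (a - t)

/-- Smooth profiles whose derivatives, and whose sum, decay like elements of `decaySpace m`. -/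
structure IsWavePair (m : ℝ) (F G : ℝ → ℝ) : Prop where
  left : ContDiff ℝ ∞ F
  right : ContDiff ℝ ∞ G
  deriv_left : deriv F ∈ decaySpace (m + 1)
  deriv_right : deriv G ∈ decaySpace (m + 1)
  add : F + G ∈ decaySpace m

theorem isWavePair_of_mem {m : ℝ} {F G : ℝ → ℝ} (hF : F ∈ decaySpace m) (hG : G ∈ decaySpace m) :
    IsWavePair m F G :=
  ⟨hF.1, hG.1, deriv_mem_decaySpace hF, deriv_mem_decaySpace hG, (decaySpace m).add_mem hF hG⟩

/-- The time derivative of `wave F G` is `wave F' (-G')`. Its profiles decay individually, one order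
better. -/
theorem IsWavePair.derivs_neg {m : ℝ} {F G : ℝ → ℝ} (h : IsWavePair m F G) :
    IsWavePair (m + 1) (deriv F) (-deriv G) :=
  isWavePair_of_mem h.deriv_left ((decaySpace _).neg_mem h.deriv_right)

theorem iteratedDeriv_wave {F G : ℝ → ℝ} (hF : ContDiff ℝ ∞ F) (hG : ContDiff ℝ ∞ G)
    (k : ℕ) (t a : ℝ) : iteratedDeriv k (wave F G t) a =
      iteratedDeriv k F (a + t) + iteratedDeriv k G (a - t) := by
  have hF' : ContDiff ℝ ∞ fun a => F (a + t) := hF.comp (by fun_prop)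
  have hG' : ContDiff ℝ ∞ fun a => G (a - t) := hG.comp (by fun_prop)
  unfold wave
  rw [iteratedDeriv_fun_add (contDiffAt_nat_of_smooth hF' k a) (contDiffAt_nat_of_smooth hG' k a),
    iteratedDeriv_comp_add_const, iteratedDeriv_comp_sub_const]

theorem deriv_wave {F G : ℝ → ℝ} (hF : ContDiff ℝ ∞ F) (hG : ContDiff ℝ ∞ G) (t : ℝ) :
    deriv (wave F G t) = wave (deriv F) (deriv G) t := by
  funext a
  have h := iteratedDeriv_wave hF hG 1 t a
  simp only [iteratedDeriv_one] at h
  exact h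

theorem contDiff_wave {F G : ℝ → ℝ} (hF : ContDiff ℝ ∞ F) (hG : ContDiff ℝ ∞ G) (t : ℝ) :
    ContDiff ℝ ∞ (wave F G t) :=
  (hF.comp (by fun_prop)).add (hG.comp (by fun_prop))

theorem hasDerivAt_wave {F G : ℝ → ℝ} (hF : ContDiff ℝ ∞ F) (hG : ContDiff ℝ ∞ G) (t a : ℝ) :
    HasDerivAt (fun s => wave F G s a) (wave (deriv F) (-deriv G) t a) t := by
  have h1 := ((hF.differentiable (by simp) (a + t)).hasDerivAt).comp_const_add a t
  have h2 := ((hG.differentiable (by simp) (a - t)).hasDerivAt).comp_const_sub a t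
  exact h1.add h2

/-- Mean value inequality: `f` may fail to decay, but its increments over bounded distances inherit
the decay of `deriv f`. -/
theorem exists_bound_sub {m : ℝ} (hm : 0 < m) {f : ℝ → ℝ} (hf : ContDiff ℝ ∞ f)
    (hf' : deriv f ∈ decaySpace (m + 1)) (T : ℝ) :
    ∃ C : ℝ, 0 ≤ C ∧ ∀ a x : ℝ, |x - a| ≤ T → |f x - f a| ≤ C * (1 + a ^ 2) ^ (-m / 2) := by
  obtain ⟨C, hC0, hC⟩ := exists_bound_near (by linarith) (bound_of_mem hf') T
  -- For negative `T` the distance condition is void; otherwise `C * T` is nonnegative and `a` lies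
  -- in the closed ball of radius `T`.
  rcases lt_or_ge T 0 with hT | hT
  · exact ⟨0, le_rfl, fun a x h => absurd ((abs_nonneg _).trans h) (not_le.2 hT)⟩
  refine ⟨C * T, by positivity, fun a x h => ?_⟩
  have h1 := (convex_closedBall a T).norm_image_sub_le_of_norm_deriv_le (f := f)
    (fun y _ => hf.differentiable (by simp) y)
    (fun y hy => hC a y (by simpa [Real.dist_eq] using hy))
    (Metric.mem_closedBall_self hT) (y := x) (by simpa [Real.dist_eq] using h)
  simp only [Real.norm_eq_abs] at h1
  have hw := (weight_pos (-(m + 1) / 2) a).le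
  calc |f x - f a| ≤ C * (1 + a ^ 2) ^ (-(m + 1) / 2) * |x - a| := h1
    _ ≤ C * (1 + a ^ 2) ^ (-(m + 1) / 2) * T := by gcongr
    _ = C * T * (1 + a ^ 2) ^ (-(m + 1) / 2) := by ring
    _ ≤ C * T * (1 + a ^ 2) ^ (-m / 2) := by
        exact mul_le_mul_of_nonneg_left (weight_anti (by linarith)) (by positivity)

/-- The value of a superposition, with the shifts varying independently in a bounded range. -/
theorem IsWavePair.exists_bound_add {m : ℝ} (hm : 0 < m) {F G : ℝ → ℝ} (h : IsWavePair m F G)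
    (T : ℝ) : ∃ C : ℝ, 0 ≤ C ∧ ∀ a x y : ℝ, |x - a| ≤ T → |y - a| ≤ T →
      |F x + G y| ≤ C * (1 + a ^ 2) ^ (-m / 2) := by
  obtain ⟨C₀, h0, hC₀⟩ := exists_bound_near hm.le (bound_of_mem h.add) 0
  obtain ⟨C₁, h1, hC₁⟩ := exists_bound_sub hm h.left h.deriv_left T
  obtain ⟨C₂, h2, hC₂⟩ := exists_bound_sub hm h.right h.deriv_right T
  refine ⟨C₀ + C₁ + C₂, by positivity, fun a x y hx hy => ?_⟩
  -- At the common point `a` the sum decays by hypothesis; moving each argument away from `a` costs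
  -- only an increment.
  have e : F x + G y = (F + G) a + (F x - F a) + (G y - G a) := by
    simp only [Pi.add_apply]; ring
  rw [e, add_mul, add_mul]
  exact (abs_add_three _ _ _).trans
    (add_le_add (add_le_add (hC₀ a a (by simp)) (hC₁ a x hx)) (hC₂ a y hy))

/-- Only order `0` needs the cancellation between `F` and `G`; from order `1` on each profile is
estimated separately. -/
theorem IsWavePair.exists_bound_iteratedDeriv {m : ℝ} (hm : 0 < m) {F G : ℝ → ℝ}
    (h : IsWavePair m F G) (k : ℕ) (T : ℝ) :
    ∃ C : ℝ, 0 ≤ C ∧ ∀ a x y : ℝ, |x - a| ≤ T → |y - a| ≤ T →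
      |iteratedDeriv k F x + iteratedDeriv k G y| ≤ C * (1 + a ^ 2) ^ (-(m + k) / 2) := by
  cases k with
  | zero => simpa using h.exists_bound_add hm T
  | succ k =>
    have hr : 0 ≤ m + 1 + k := by positivity
    obtain ⟨C₁, h1, hC₁⟩ := exists_bound_near hr (h.deriv_left.2 k) T
    obtain ⟨C₂, h2, hC₂⟩ := exists_bound_near hr (h.deriv_right.2 k) T
    refine ⟨C₁ + C₂, by positivity, fun a x y hx hy => ?_⟩
    rw [iteratedDeriv_succ', iteratedDeriv_succ', add_mul]
    push_cast
    rw [show m + ((k : ℝ) + 1) = m + 1 + k by ring]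
    exact (abs_add_le _ _).trans (add_le_add (hC₁ a x hx) (hC₂ a y hy))

theorem IsWavePair.exists_bound_wave {m : ℝ} (hm : 0 < m) {F G : ℝ → ℝ} (h : IsWavePair m F G)
    (T : ℝ) : ∃ C : ℝ, 0 ≤ C ∧ ∀ t, |t| ≤ T → ∀ a,
      |wave F G t a| ≤ C * (1 + a ^ 2) ^ (-m / 2) := by
  obtain ⟨C, h0, hC⟩ := h.exists_bound_add hm T
  exact ⟨C, h0, fun t ht a => hC a _ _ (by simpa using ht) (by simpa using ht)⟩

theorem IsWavePair.wave_mem {m : ℝ} (hm : 0 < m) {F G : ℝ → ℝ} (h : IsWavePair m F G) (t : ℝ) :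
    wave F G t ∈ decaySpace m := by
  refine ⟨contDiff_wave h.left h.right t, fun k => ?_⟩
  obtain ⟨C, -, hC⟩ := h.exists_bound_iteratedDeriv hm k |t|
  refine ⟨C, fun a => ?_⟩
  rw [iteratedDeriv_wave h.left h.right]
  exact hC a _ _ (by simp) (by simp)

/-- The mean value inequality is used twice, for `deriv f` and then for `y ↦ f y - deriv f x * y`;
the missing factor `1 / 2` is irrelevant. -/
theorem abs_taylor_one_le {f : ℝ → ℝ} (hf : ContDiff ℝ ∞ f) {x h B : ℝ} (hB : 0 ≤ B)
    (hb : ∀ y, |y - x| ≤ |h| → |deriv (deriv f) y| ≤ B) :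
    |f (x + h) - f x - h * deriv f x| ≤ B * h ^ 2 := by
  have hf' := contDiff_deriv_of_smooth hf
  have hmem : x ∈ Metric.closedBall x |h| := Metric.mem_closedBall_self (abs_nonneg h)
  have h1 : ∀ y ∈ Metric.closedBall x |h|, ‖deriv f y - deriv f x‖ ≤ B * |h| := fun y hy => by
    have hy' : |y - x| ≤ |h| := by simpa [Real.dist_eq] using hy
    have := (convex_closedBall x |h|).norm_image_sub_le_of_norm_deriv_le (f := deriv f)
      (fun z _ => hf'.differentiable (by simp) z)
      (fun z hz => hb z (by simpa [Real.dist_eq] using hz)) hmem hy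
    exact this.trans (mul_le_mul_of_nonneg_left hy' hB)
  have h2 := (convex_closedBall x |h|).norm_image_sub_le_of_norm_hasDerivWithin_le
    (f := fun y => f y - deriv f x * y) (f' := fun y => deriv f y - deriv f x)
    (C := B * |h|) (fun y _ => by
      have := ((hf.differentiable (by simp) y).hasDerivAt).fun_sub
        ((hasDerivAt_id' y).const_mul (deriv f x))
      simpa using this.hasDerivWithinAt) h1 hmem (y := x + h) (by simp)
  have e : f (x + h) - deriv f x * (x + h) - (f x - deriv f x * x)
      = f (x + h) - f x - h * deriv f x := by ring
  rw [e] at h2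
  simp only [Real.norm_eq_abs, add_sub_cancel_left] at h2
  calc _ ≤ B * |h| * |h| := h2
    _ = B * h ^ 2 := by rw [mul_assoc, ← sq, sq_abs]

/-- Difference quotients of a travelling wave converge, uniformly with weights. -/
theorem eventually_abs_slope_sub_le {m : ℝ} (hm : 0 < m) {f : ℝ → ℝ} (hf : ContDiff ℝ ∞ f)
    (hf' : deriv f ∈ decaySpace (m + 1)) (k : ℕ) (t : ℝ) {ε : ℝ} (hε : 0 < ε) :
    ∀ᶠ h in 𝓝[≠] (0 : ℝ), ∀ a : ℝ,
      |h⁻¹ * (iteratedDeriv k f (a + t + h) - iteratedDeriv k f (a + t))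
        - iteratedDeriv (k + 1) f (a + t)| ≤ ε * (1 + a ^ 2) ^ (-(m + k) / 2) := by
  -- The Taylor remainder of the `k`-th derivative involves order `k + 2` of `f`, that is, order `k
  -- + 1` of `deriv f`. The radius `|t| + 1` allows for the shift `t` and a step with `|h| < 1`.
  obtain ⟨C, hC0, hC⟩ := exists_bound_near (by positivity) (hf'.2 (k + 1)) (|t| + 1)
  have hlim : Filter.Tendsto (fun h : ℝ => C * |h|) (𝓝[≠] 0) (𝓝 0) := by
    have : Continuous fun h : ℝ => C * |h| := by fun_prop
    simpa using (this.tendsto 0).mono_left nhdsWithin_le_nhds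
  have hone : ∀ᶠ h : ℝ in 𝓝[≠] 0, |h| < 1 := by
    have : Continuous fun h : ℝ => |h| := by fun_prop
    have h2 : Filter.Tendsto (fun h : ℝ => |h|) (𝓝[≠] 0) (𝓝 0) := by
      simpa using (this.tendsto 0).mono_left nhdsWithin_le_nhds
    exact h2.eventually_lt_const one_pos
  filter_upwards [hlim.eventually_lt_const hε, hone, self_mem_nhdsWithin] with h h1 h2 h3 a
  have h0 : h ≠ 0 := h3
  have hs : ContDiff ℝ ∞ (iteratedDeriv k f) := by
    rw [iteratedDeriv_eq_iterate]
    exact hf.iterate_deriv k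
  have hw := weight_pos (-(m + k) / 2) a
  have key := abs_taylor_one_le hs (x := a + t) (h := h)
    (B := C * (1 + a ^ 2) ^ (-(m + k) / 2)) (by positivity) fun y hy => by
      have h4 : |y - a| ≤ |t| + 1 := by
        have e : y - a = (y - (a + t)) + t := by ring
        rw [e]
        linarith [abs_add_le (y - (a + t)) t]
      have h5 := hC a y h4
      rw [← iteratedDeriv_succ', iteratedDeriv_succ, iteratedDeriv_succ] at h5
      exact h5.trans (mul_le_mul_of_nonneg_left (weight_anti (by push_cast; linarith)) hC0)
  have e : h⁻¹ * (iteratedDeriv k f (a + t + h) - iteratedDeriv k f (a + t))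
      - iteratedDeriv (k + 1) f (a + t) = h⁻¹ * (iteratedDeriv k f (a + t + h)
        - iteratedDeriv k f (a + t) - h * deriv (iteratedDeriv k f) (a + t)) := by
    rw [iteratedDeriv_succ]; field_simp
  rw [e, abs_mul, abs_inv, inv_mul_le_iff₀ (abs_pos.2 h0)]
  calc _ ≤ C * (1 + a ^ 2) ^ (-(m + k) / 2) * h ^ 2 := key
    _ = |h| * (C * |h| * (1 + a ^ 2) ^ (-(m + k) / 2)) := by rw [← sq_abs h]; ring
    _ ≤ |h| * (ε * (1 + a ^ 2) ^ (-(m + k) / 2)) := by gcongr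

theorem IsWavePair.eventually_abs_slope_sub_le {m : ℝ} (hm : 0 < m) {F G : ℝ → ℝ}
    (hw : IsWavePair m F G) (k : ℕ) (t : ℝ) {ε : ℝ} (hε : 0 < ε) :
    ∀ᶠ h in 𝓝[≠] (0 : ℝ), ∀ a : ℝ,
      |iteratedDeriv k (h⁻¹ • (wave F G (t + h) - wave F G t)
        - wave (deriv F) (-deriv G) t) a| ≤ ε * (1 + a ^ 2) ^ (-(m + k) / 2) := by
  have h1 := MinkowskiStrip.eventually_abs_slope_sub_le hm hw.left hw.deriv_left k t (half_pos hε)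
  have h2 := MinkowskiStrip.eventually_abs_slope_sub_le hm hw.right hw.deriv_right k (-t)
    (half_pos hε)
  -- The right-moving part is a difference quotient at `-t` with step `-h`.
  have hneg : Filter.Tendsto (fun h : ℝ => -h) (𝓝[≠] 0) (𝓝[≠] 0) := by
    refine tendsto_nhdsWithin_iff.2 ⟨?_, ?_⟩
    · simpa using (continuous_neg.tendsto (0 : ℝ)).mono_left nhdsWithin_le_nhds
    · filter_upwards [self_mem_nhdsWithin] with h hh
      simpa using hh
  filter_upwards [h1, hneg.eventually h2] with h h1 h2 a
  have s1 := contDiff_wave hw.left hw.right (t + h)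
  have s2 := contDiff_wave hw.left hw.right t
  have s3 : ContDiff ℝ ∞ (wave (deriv F) (-deriv G) t) :=
    contDiff_wave (contDiff_deriv_of_smooth hw.left) (contDiff_deriv_of_smooth hw.right).neg t
  have s4 : ContDiff ℝ ∞ (wave F G (t + h) - wave F G t) := s1.sub s2
  have s5 : ContDiff ℝ ∞ (h⁻¹ • (wave F G (t + h) - wave F G t)) := contDiff_const.smul s4
  rw [iteratedDeriv_sub (contDiffAt_nat_of_smooth s5 k a)
      (contDiffAt_nat_of_smooth s3 k a),
    iteratedDeriv_const_smul (contDiffAt_nat_of_smooth s4 k a),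
    iteratedDeriv_sub (contDiffAt_nat_of_smooth s1 k a) (contDiffAt_nat_of_smooth s2 k a),
    iteratedDeriv_wave hw.left hw.right, iteratedDeriv_wave hw.left hw.right,
    iteratedDeriv_wave (G := -deriv G) (contDiff_deriv_of_smooth hw.left)
      (contDiff_deriv_of_smooth hw.right).neg, iteratedDeriv_neg,
    ← iteratedDeriv_succ', ← iteratedDeriv_succ']
  have e : h⁻¹ • (iteratedDeriv k F (a + (t + h)) + iteratedDeriv k G (a - (t + h))
      - (iteratedDeriv k F (a + t) + iteratedDeriv k G (a - t)))
      - (iteratedDeriv (k + 1) F (a + t) + -iteratedDeriv (k + 1) G (a - t))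
      = (h⁻¹ * (iteratedDeriv k F (a + t + h) - iteratedDeriv k F (a + t))
        - iteratedDeriv (k + 1) F (a + t))
      - ((-h)⁻¹ * (iteratedDeriv k G (a + -t + -h) - iteratedDeriv k G (a + -t))
        - iteratedDeriv (k + 1) G (a + -t)) := by
    rw [inv_neg, smul_eq_mul, show a + (t + h) = a + t + h by ring,
      show a - (t + h) = a + -t + -h by ring, show a - t = a + -t by ring]
    ring
  rw [e]
  refine (abs_sub _ _).trans ((add_le_add (h1 a) (h2 a)).trans (le_of_eq ?_))
  ring

/-! ### The flow of the wave equation -/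

theorem mem_decaySpace_of_le {m m' : ℝ} (h : m ≤ m') {f : ℝ → ℝ} (hf : f ∈ decaySpace m') :
    f ∈ decaySpace m := by
  refine ⟨hf.1, fun k => ?_⟩
  obtain ⟨C, hC⟩ := hf.2 k
  have hC0 : 0 ≤ C := by simpa using (abs_nonneg _).trans (hC 0)
  exact ⟨C, fun a => (hC a).trans (mul_le_mul_of_nonneg_left (weight_anti (by linarith)) hC0)⟩

/-- The profile moving in the direction of decreasing `a`. -/
def leftMover {η : ℝ} (p : PrePhase η) (a : ℝ) : ℝ :=
  2⁻¹ * ((p.1 : ℝ → ℝ) a + ∫ x in (0 : ℝ)..a, (p.2 : ℝ → ℝ) x)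

/-- The profile moving in the direction of increasing `a`. -/
def rightMover {η : ℝ} (p : PrePhase η) (a : ℝ) : ℝ :=
  2⁻¹ * ((p.1 : ℝ → ℝ) a - ∫ x in (0 : ℝ)..a, (p.2 : ℝ → ℝ) x)

section

variable {η : ℝ} (p : PrePhase η)

theorem hasDerivAt_leftMover (a : ℝ) : HasDerivAt (leftMover p)
    (2⁻¹ * (deriv (p.1 : ℝ → ℝ) a + (p.2 : ℝ → ℝ) a)) a :=
  ((differentiable_of_mem p.1 a).hasDerivAt.add
    (Continuous.integral_hasStrictDerivAt p.2.2.1.continuous 0 a).hasDerivAt).const_mul 2⁻¹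

theorem hasDerivAt_rightMover (a : ℝ) : HasDerivAt (rightMover p)
    (2⁻¹ * (deriv (p.1 : ℝ → ℝ) a - (p.2 : ℝ → ℝ) a)) a :=
  ((differentiable_of_mem p.1 a).hasDerivAt.sub
    (Continuous.integral_hasStrictDerivAt p.2.2.1.continuous 0 a).hasDerivAt).const_mul 2⁻¹

theorem deriv_leftMover : deriv (leftMover p) =
    (2⁻¹ : ℝ) • (deriv (p.1 : ℝ → ℝ) + (p.2 : ℝ → ℝ)) :=
  funext fun a => (hasDerivAt_leftMover p a).deriv

theorem deriv_rightMover : deriv (rightMover p) =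
    (2⁻¹ : ℝ) • (deriv (p.1 : ℝ → ℝ) - (p.2 : ℝ → ℝ)) :=
  funext fun a => (hasDerivAt_rightMover p a).deriv

theorem leftMover_add_rightMover : leftMover p + rightMover p = (p.1 : ℝ → ℝ) := by
  funext a
  simp only [Pi.add_apply, leftMover, rightMover]
  ring

theorem isWavePair_movers : IsWavePair η (leftMover p) (rightMover p) := by
  have hl : deriv (leftMover p) ∈ decaySpace (η + 1) := by
    rw [deriv_leftMover]
    exact (decaySpace _).smul_mem _ ((decaySpace _).add_mem (deriv_mem_decaySpace p.1.2) p.2.2)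
  have hr : deriv (rightMover p) ∈ decaySpace (η + 1) := by
    rw [deriv_rightMover]
    exact (decaySpace _).smul_mem _ ((decaySpace _).sub_mem (deriv_mem_decaySpace p.1.2) p.2.2)
  refine ⟨contDiff_infty_iff_deriv.2 ⟨fun a => (hasDerivAt_leftMover p a).differentiableAt, hl.1⟩,
    contDiff_infty_iff_deriv.2 ⟨fun a => (hasDerivAt_rightMover p a).differentiableAt, hr.1⟩,
    hl, hr, ?_⟩
  rw [leftMover_add_rightMover]
  exact p.1.2

end

/-- The flow of the wave equation on the pre-phase space. -/
def waveFlow {η : ℝ} (hη : 0 < η) (t : ℝ) (p : PrePhase η) : PrePhase η :=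
  (⟨wave (leftMover p) (rightMover p) t, (isWavePair_movers p).wave_mem hη t⟩,
    ⟨wave (deriv (leftMover p)) (-deriv (rightMover p)) t,
      (isWavePair_movers p).derivs_neg.wave_mem (by linarith) t⟩)

/-- The flow can be computed from any splitting into travelling profiles. -/
theorem waveFlow_eq {η : ℝ} (hη : 0 < η) {p : PrePhase η} {F G : ℝ → ℝ}
    (hF : Differentiable ℝ F) (hG : Differentiable ℝ G)
    (h1 : F + G = (p.1 : ℝ → ℝ)) (h2 : deriv F - deriv G = (p.2 : ℝ → ℝ)) (t : ℝ) :
    ((waveFlow hη t p).1 : ℝ → ℝ) = wave F G t ∧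
      ((waveFlow hη t p).2 : ℝ → ℝ) = wave (deriv F) (-deriv G) t := by
  have hd : deriv (p.1 : ℝ → ℝ) = deriv F + deriv G := by
    rw [← h1]
    funext a
    exact deriv_add (hF a) (hG a)
  have hl : deriv (leftMover p) = deriv F := by
    rw [deriv_leftMover, hd, ← h2]
    funext a
    simp only [Pi.smul_apply, Pi.add_apply, Pi.sub_apply, smul_eq_mul]
    ring
  have hr : deriv (rightMover p) = deriv G := by
    rw [deriv_rightMover, hd, ← h2]
    funext a
    simp only [Pi.smul_apply, Pi.add_apply, Pi.sub_apply, smul_eq_mul]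
    ring
  have hdl : Differentiable ℝ (leftMover p) := fun a => (hasDerivAt_leftMover p a).differentiableAt
  -- Two splittings of the same data differ by a constant added to the left profile and subtracted
  -- from the right one, which cancels in the wave.
  have hc : ∀ x y, (leftMover p - F) x = (leftMover p - F) y :=
    is_const_of_deriv_eq_zero (hdl.sub hF) fun a => by
      rw [deriv_sub (hdl a) (hF a), hl, sub_self]
  refine ⟨?_, ?_⟩
  · funext a
    change leftMover p (a + t) + rightMover p (a - t) = F (a + t) + G (a - t)
    have e1 := hc (a + t) (a - t)
    have e2 := congrFun (leftMover_add_rightMover p) (a - t)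
    have e3 := congrFun h1 (a - t)
    simp only [Pi.add_apply, Pi.sub_apply] at e1 e2 e3
    linarith
  · change wave (deriv (leftMover p)) (-deriv (rightMover p)) t = _
    rw [hl, hr]

theorem prePhase_ext {η : ℝ} {p q : PrePhase η} (h1 : (p.1 : ℝ → ℝ) = q.1)
    (h2 : (p.2 : ℝ → ℝ) = q.2) : p = q :=
  Prod.ext (Subtype.ext h1) (Subtype.ext h2)

theorem waveFlow_zero {η : ℝ} (hη : 0 < η) (p : PrePhase η) : waveFlow hη 0 p = p := by
  refine prePhase_ext (funext fun a => ?_) (funext fun a => ?_)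
  · change leftMover p (a + 0) + rightMover p (a - 0) = _
    rw [add_zero, sub_zero, ← leftMover_add_rightMover p]
    rfl
  · change deriv (leftMover p) (a + 0) + -deriv (rightMover p) (a - 0) = _
    rw [add_zero, sub_zero, deriv_leftMover, deriv_rightMover]
    simp only [Pi.smul_apply, Pi.add_apply, Pi.sub_apply, smul_eq_mul]
    ring

/-- The shifted profiles split the state at time `t`, so `waveFlow_eq` evaluates the second stage
without integrating again. -/
theorem waveFlow_add {η : ℝ} (hη : 0 < η) (s t : ℝ) (p : PrePhase η) :
    waveFlow hη (s + t) p = waveFlow hη s (waveFlow hη t p) := by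
  have hw := isWavePair_movers p
  have hF : Differentiable ℝ fun a => leftMover p (a + t) :=
    (hw.left.differentiable (by simp)).comp (by fun_prop)
  have hG : Differentiable ℝ fun a => rightMover p (a - t) :=
    (hw.right.differentiable (by simp)).comp (by fun_prop)
  have dF : deriv (fun a => leftMover p (a + t)) = fun a => deriv (leftMover p) (a + t) :=
    funext fun a => deriv_comp_add_const _ _ _
  have dG : deriv (fun a => rightMover p (a - t)) = fun a => deriv (rightMover p) (a - t) :=
    funext fun a => deriv_comp_sub_const _ _ _
  obtain ⟨h1, h2⟩ := waveFlow_eq hη (p := waveFlow hη t p) hF hG rfl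
    (by rw [dF, dG]; funext a; exact sub_eq_add_neg _ _) s
  refine prePhase_ext ?_ ?_
  · rw [h1]
    funext a
    change leftMover p (a + (s + t)) + rightMover p (a - (s + t)) =
      leftMover p (a + s + t) + rightMover p (a - s - t)
    rw [add_assoc, sub_sub]
  · rw [h2, dF, dG]
    funext a
    change deriv (leftMover p) (a + (s + t)) + -deriv (rightMover p) (a - (s + t)) =
      deriv (leftMover p) (a + s + t) + -deriv (rightMover p) (a - s - t)
    rw [add_assoc, sub_sub]

/-- The vector field `(φ, π) ↦ (π, φ'')`. -/
def waveField {η : ℝ} (p : PrePhase η) : PrePhase η :=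
  (⟨p.2, mem_decaySpace_of_le (by linarith) p.2.2⟩,
    ⟨deriv (deriv (p.1 : ℝ → ℝ)), mem_decaySpace_of_le (by linarith)
      (deriv_mem_decaySpace (deriv_mem_decaySpace p.1.2))⟩)

theorem neg_deriv_neg (f : ℝ → ℝ) : -deriv (-f) = deriv f := by
  rw [show deriv (-f) = -deriv f from funext fun a => deriv.neg, neg_neg]

/-- The second space derivative equals the second time derivative. The double sign is kept so that
the profiles are those of `IsWavePair.derivs_neg` applied twice. -/
theorem waveField_waveFlow_snd {η : ℝ} (hη : 0 < η) (t : ℝ) (p : PrePhase η) :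
    ((waveField (waveFlow hη t p)).2 : ℝ → ℝ) =
      wave (deriv (deriv (leftMover p))) (-deriv (-deriv (rightMover p))) t := by
  have hw := isWavePair_movers p
  change deriv (deriv (wave (leftMover p) (rightMover p) t)) = _
  rw [deriv_wave hw.left hw.right, deriv_wave hw.deriv_left.1 hw.deriv_right.1, neg_deriv_neg]

theorem hasFrechetDerivAt_waveFlow {η : ℝ} (hη : 0 < η) (t : ℝ) (p : PrePhase η) :
    HasFrechetDerivAt (fun s => waveFlow hη s p) (waveField (waveFlow hη t p)) t := by
  have hw := isWavePair_movers p
  intro k ε hε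
  filter_upwards [hw.eventually_abs_slope_sub_le hη k t hε,
    hw.derivs_neg.eventually_abs_slope_sub_le (by linarith : 0 < η + 1) k t hε] with h h1 h2 a
  refine ⟨h1 a, ?_⟩
  have h3 := h2 a
  rw [← waveField_waveFlow_snd hη] at h3
  exact h3

/-! ### The canonical symplectic form and the Hamiltonian -/

/-- The coefficients of `α̃` for a frame with `n` the Minkowski conjugate of `τ`. -/
theorem bdry_of_conjugate {τ n : ℝ × ℝ} (hn : n = (τ.2, τ.1)) (hτ : τ.1 ^ 2 - τ.2 ^ 2 ≠ 0) :
    bdryDensity τ n * bdryGamma τ n = 1 ∧ bdryDrift τ n = 0 := by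
  obtain ⟨x, y⟩ := τ
  subst hn
  simp only at hτ
  have h1 : x * x - y * y ≠ 0 := by intro h; apply hτ; linarith
  have h2 : y * y - x * x ≠ 0 := by intro h; apply hτ; linarith
  constructor
  · simp only [bdryDensity, bdryGamma, raisedConormal, conormal, area]
    field_simp
    ring
  · simp only [bdryDrift, bdryGamma, raisedConormal, conormal, area, Prod.fst_sub, Prod.snd_sub,
      Prod.smul_fst, Prod.smul_snd, smul_eq_mul]
    field_simp
    ring

theorem conjugate_of_frame {τ n : ℝ × ℝ} (h : IsSpacelikeFrame τ n ∨ IsTimelikeFrame τ n) :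
    n = (τ.2, τ.1) ∧ τ.1 ^ 2 - τ.2 ^ 2 ≠ 0 := by
  obtain ⟨x, y⟩ := τ
  obtain ⟨u, v⟩ := n
  rcases h with ⟨h1, h2, h3, h4⟩ | ⟨h1, h2, h3, h4⟩ <;>
    simp only [mink, area] at h1 h2 h3 h4
  -- Gram identity: the squared area is `g(τ,n)² - g(τ,τ) g(n,n)`. The orientation selects the root
  -- `1`, and area and orthogonality then determine `n` linearly.
  · have hA : (x * v - y * u) * (x * v - y * u) = 1 := by
      linear_combination (x * u - y * v) * h3 - (u * u - v * v) * h1 - h2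
    have hA1 : x * v - y * u = 1 := by nlinarith
    refine ⟨Prod.ext ?_ ?_, ?_⟩
    · simp only; linear_combination y * hA1 - u * h1 + x * h3
    · simp only; linear_combination x * hA1 - v * h1 + y * h3
    · simp only; intro h; linarith
  · have hA : (u * y - v * x) * (u * y - v * x) = 1 := by
      linear_combination (x * u - y * v) * h3 - (u * u - v * v) * h1 + h2
    have hA1 : u * y - v * x = 1 := by nlinarith
    refine ⟨Prod.ext ?_ ?_, ?_⟩
    · simp only; linear_combination y * hA1 + u * h1 - x * h3
    · simp only; linear_combination x * hA1 + v * h1 - y * h3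
    · simp only; intro h; linarith

theorem preForm_apply {η : ℝ} (hη : 0 < η) (τ n : ℝ × ℝ) (p q : PrePhase η) :
    preForm η hη τ n p q =
      (bdryDensity τ n * ∫ a : ℝ, (bdryGamma τ n * (p.2 : ℝ → ℝ) a
        + bdryDrift τ n * deriv (p.1 : ℝ → ℝ) a) * (q.1 : ℝ → ℝ) a)
      - bdryDensity τ n * ∫ a : ℝ, (bdryGamma τ n * (q.2 : ℝ → ℝ) a
        + bdryDrift τ n * deriv (q.1 : ℝ → ℝ) a) * (p.1 : ℝ → ℝ) a := rfl

theorem preForm_of_conjugate {η : ℝ} (hη : 0 < η) {τ n : ℝ × ℝ} (hn : n = (τ.2, τ.1))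
    (hτ : τ.1 ^ 2 - τ.2 ^ 2 ≠ 0) (p q : PrePhase η) :
    preForm η hη τ n p q =
      ∫ a : ℝ, ((p.2 : ℝ → ℝ) a * (q.1 : ℝ → ℝ) a - (q.2 : ℝ → ℝ) a * (p.1 : ℝ → ℝ) a) := by
  obtain ⟨h1, h2⟩ := bdry_of_conjugate hn hτ
  rw [preForm_apply, h2, MeasureTheory.integral_sub (integrable_mul hη p.2 q.1)
    (integrable_mul hη q.2 p.1)]
  simp only [zero_mul, add_zero, mul_assoc]
  rw [MeasureTheory.integral_const_mul, MeasureTheory.integral_const_mul, ← mul_assoc, ← mul_assoc,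
    h1, one_mul, one_mul]

/-- The fundamental lemma of the calculus of variations; continuity upgrades almost everywhere to
everywhere. -/
theorem eq_zero_of_forall_integral_mul {f : ℝ → ℝ} (hf : Continuous f)
    (h : ∀ g : ℝ → ℝ, ContDiff ℝ ∞ g → HasCompactSupport g → ∫ a, g a * f a = 0) : f = 0 := by
  have h1 := ae_eq_zero_of_integral_contDiff_smul_eq_zero
    (hf.locallyIntegrable (μ := MeasureTheory.volume)) h
  exact (Continuous.ae_eq_iff_eq MeasureTheory.volume hf continuous_zero).1 h1

theorem ker_preForm_of_conjugate {η : ℝ} (hη : 0 < η) {τ n : ℝ × ℝ} (hn : n = (τ.2, τ.1))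
    (hτ : τ.1 ^ 2 - τ.2 ^ 2 ≠ 0) : LinearMap.ker (preForm η hη τ n) = ⊥ := by
  rw [LinearMap.ker_eq_bot']
  intro p hp
  have hp' : ∀ q : PrePhase η, ∫ a : ℝ, ((p.2 : ℝ → ℝ) a * (q.1 : ℝ → ℝ) a
      - (q.2 : ℝ → ℝ) a * (p.1 : ℝ → ℝ) a) = 0 := fun q => by
    rw [← preForm_of_conjugate hη hn hτ, hp]; rfl
  refine prePhase_ext ?_ ?_
  · refine eq_zero_of_forall_integral_mul p.1.2.1.continuous fun g hg hc => ?_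
    have h := hp' (0, ⟨g, mem_decaySpace_of_hasCompactSupport _ hg hc⟩)
    simpa [MeasureTheory.integral_neg] using h
  · refine eq_zero_of_forall_integral_mul p.2.2.1.continuous fun g hg hc => ?_
    have h := hp' (⟨g, mem_decaySpace_of_hasCompactSupport _ hg hc⟩, 0)
    simpa [mul_comm] using h

/-- Integration by parts for decaying functions. -/
theorem integral_deriv_mul_eq_neg {m m' : ℝ} (h : 0 < m + m') {f g : ℝ → ℝ}
    (hf : deriv f ∈ decaySpace (m + 1)) (hfd : Differentiable ℝ f)
    (hg : g ∈ decaySpace m') (hfg : MeasureTheory.Integrable fun a => f a * g a)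
    (hfg' : MeasureTheory.Integrable fun a => f a * deriv g a) :
    ∫ a, deriv f a * g a = -∫ a, f a * deriv g a := by
  have h1 := MeasureTheory.integral_mul_deriv_eq_deriv_mul_of_integrable
    (u := f) (v := g) (u' := deriv f) (v' := deriv g) (fun x _ => (hfd x).hasDerivAt)
    (fun x _ => (hg.1.differentiable (by simp) x).hasDerivAt) hfg'
    (integrable_mul_of_mem (by linarith) hf hg) hfg
  linarith

/-- `H` is quadratic, so `t ↦ H (p + t • w)` is a polynomial of degree at most two. Its linear
coefficient `∫ (π_w π_p + φ_p' φ_w')` is matched with `ω̃(w, X p)` by one integration by parts. -/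
theorem isHamiltonianVectorField_waveField {η : ℝ} (hη : 0 < η) {τ n : ℝ × ℝ}
    (hn : n = (τ.2, τ.1)) (hτ : τ.1 ^ 2 - τ.2 ^ 2 ≠ 0) :
    IsHamiltonianVectorField (preForm η hη τ n) (hamiltonian (η := η)) waveField := by
  intro p w
  have dp := deriv_mem_decaySpace p.1.2
  have dw := deriv_mem_decaySpace w.1.2
  have i1 := integrable_mul_of_mem (by linarith) p.2.2 p.2.2
  have i2 := integrable_mul_of_mem (by linarith) w.2.2 w.2.2
  have i3 := integrable_mul_of_mem (by linarith) w.2.2 p.2.2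
  have j1 := integrable_mul_of_mem (by linarith) dp dp
  have j2 := integrable_mul_of_mem (by linarith) dw dw
  have j3 := integrable_mul_of_mem (by linarith) dp dw
  have k1 := i1.fun_add j1
  have k2 := i2.fun_add j2
  have k3 := i3.fun_add j3
  have hH : ∀ t : ℝ, hamiltonian (p + t • w) =
      1 / 2 * (∫ a, (p.2 : ℝ → ℝ) a * (p.2 : ℝ → ℝ) a
          + deriv (p.1 : ℝ → ℝ) a * deriv (p.1 : ℝ → ℝ) a)
        + t * (∫ a, (w.2 : ℝ → ℝ) a * (p.2 : ℝ → ℝ) a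
          + deriv (p.1 : ℝ → ℝ) a * deriv (w.1 : ℝ → ℝ) a)
        + t ^ 2 * (1 / 2 * (∫ a, (w.2 : ℝ → ℝ) a * (w.2 : ℝ → ℝ) a
          + deriv (w.1 : ℝ → ℝ) a * deriv (w.1 : ℝ → ℝ) a)) := fun t => by
    have hd : ∀ a, deriv (((p + t • w).1 : decaySpace η) : ℝ → ℝ) a =
        deriv (p.1 : ℝ → ℝ) a + t * deriv (w.1 : ℝ → ℝ) a := fun a =>
      ((differentiable_of_mem p.1 a).hasDerivAt.add
        ((differentiable_of_mem w.1 a).hasDerivAt.const_mul t)).deriv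
    have hs : ∀ a, (((p + t • w).2 : decaySpace (η + 1)) : ℝ → ℝ) a =
        (p.2 : ℝ → ℝ) a + t * (w.2 : ℝ → ℝ) a := fun a => rfl
    unfold hamiltonian
    simp only [hd, hs]
    rw [← MeasureTheory.integral_const_mul, ← MeasureTheory.integral_const_mul,
      ← MeasureTheory.integral_const_mul, ← MeasureTheory.integral_const_mul,
      ← MeasureTheory.integral_const_mul,
      ← MeasureTheory.integral_add (k1.const_mul _) (k3.const_mul _),
      ← MeasureTheory.integral_add ((k1.const_mul _).fun_add (k3.const_mul _))
        ((k2.const_mul _).const_mul _)]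
    refine MeasureTheory.integral_congr_ae (Filter.Eventually.of_forall fun a => ?_)
    simp only
    ring
  have hX : preForm η hη τ n w (waveField p) = ∫ a, (w.2 : ℝ → ℝ) a * (p.2 : ℝ → ℝ) a
      + deriv (p.1 : ℝ → ℝ) a * deriv (w.1 : ℝ → ℝ) a := by
    have ddp := deriv_mem_decaySpace dp
    rw [preForm_of_conjugate hη hn hτ]
    change ∫ a, ((w.2 : ℝ → ℝ) a * (p.2 : ℝ → ℝ) a
      - deriv (deriv (p.1 : ℝ → ℝ)) a * (w.1 : ℝ → ℝ) a) = _
    rw [MeasureTheory.integral_sub i3 (integrable_mul_of_mem (by linarith) ddp w.1.2),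
      MeasureTheory.integral_add i3 j3,
      integral_deriv_mul_eq_neg (by linarith) ddp (dp.1.differentiable (by simp)) w.1.2
        (integrable_mul_of_mem (by linarith) dp w.1.2) j3, sub_neg_eq_add]
  rw [hX]
  simp only [hH]
  have := ((hasDerivAt_id' (0 : ℝ)).mul_const (∫ a, (w.2 : ℝ → ℝ) a * (p.2 : ℝ → ℝ) a
      + deriv (p.1 : ℝ → ℝ) a * deriv (w.1 : ℝ → ℝ) a)).const_add
        (1 / 2 * (∫ a, (p.2 : ℝ → ℝ) a * (p.2 : ℝ → ℝ) a
          + deriv (p.1 : ℝ → ℝ) a * deriv (p.1 : ℝ → ℝ) a))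
  have h2 := (((hasDerivAt_id' (0 : ℝ)).pow 2).mul_const
    (1 / 2 * (∫ a, (w.2 : ℝ → ℝ) a * (w.2 : ℝ → ℝ) a
          + deriv (w.1 : ℝ → ℝ) a * deriv (w.1 : ℝ → ℝ) a)))
  simpa using this.fun_add h2

theorem isHamiltonianFlow_waveFlow {η : ℝ} (hη : 0 < η) {τ n : ℝ × ℝ}
    (hn : n = (τ.2, τ.1)) (hτ : τ.1 ^ 2 - τ.2 ^ 2 ≠ 0) :
    IsHamiltonianFlow (preForm η hη τ n) hamiltonian (waveFlow hη) :=
  ⟨waveField, isHamiltonianVectorField_waveField hη hn hτ, waveFlow_zero hη, waveFlow_add hη,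
    hasFrechetDerivAt_waveFlow hη⟩

/-! ### The flow is symplectic -/

/-- Symmetry of `∂²`: each term integrates by parts to `∫ φ_p' φ_q'` up to the same sign. This is
the infinitesimal invariance of `ω̃`. -/
theorem integral_waveField_eq_zero {η : ℝ} (hη : 0 < η) (p q : PrePhase η) :
    ∫ a, ((waveField p).2 : ℝ → ℝ) a * (q.1 : ℝ → ℝ) a
      - ((waveField q).2 : ℝ → ℝ) a * (p.1 : ℝ → ℝ) a = 0 := by
  have dp := deriv_mem_decaySpace p.1.2
  have dq := deriv_mem_decaySpace q.1.2
  have ddp := deriv_mem_decaySpace dp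
  have ddq := deriv_mem_decaySpace dq
  change ∫ a, deriv (deriv (p.1 : ℝ → ℝ)) a * (q.1 : ℝ → ℝ) a
    - deriv (deriv (q.1 : ℝ → ℝ)) a * (p.1 : ℝ → ℝ) a = 0
  rw [MeasureTheory.integral_sub (integrable_mul_of_mem (by linarith) ddp q.1.2)
      (integrable_mul_of_mem (by linarith) ddq p.1.2),
    integral_deriv_mul_eq_neg (by linarith) ddp (dp.1.differentiable (by simp)) q.1.2
      (integrable_mul_of_mem (by linarith) dp q.1.2)
      (integrable_mul_of_mem (by linarith) dp dq),
    integral_deriv_mul_eq_neg (by linarith) ddq (dq.1.differentiable (by simp)) p.1.2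
      (integrable_mul_of_mem (by linarith) dq p.1.2)
      (integrable_mul_of_mem (by linarith) dq dp)]
  simp only [mul_comm (deriv (q.1 : ℝ → ℝ) _)]
  ring

/-- The integrand of the symplectic form along the flow. -/
def symplecticDensity {η : ℝ} (hη : 0 < η) (p q : PrePhase η) (t a : ℝ) : ℝ :=
  ((waveFlow hη t p).2 : ℝ → ℝ) a * ((waveFlow hη t q).1 : ℝ → ℝ) a
    - ((waveFlow hη t q).2 : ℝ → ℝ) a * ((waveFlow hη t p).1 : ℝ → ℝ) a

/-- The time derivative of the integrand. -/
def symplecticDensityDeriv {η : ℝ} (hη : 0 < η) (p q : PrePhase η) (t a : ℝ) : ℝ :=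
  ((waveField (waveFlow hη t p)).2 : ℝ → ℝ) a * ((waveFlow hη t q).1 : ℝ → ℝ) a
    - ((waveField (waveFlow hη t q)).2 : ℝ → ℝ) a * ((waveFlow hη t p).1 : ℝ → ℝ) a

theorem hasDerivAt_symplecticDensity {η : ℝ} (hη : 0 < η) (p q : PrePhase η) (t a : ℝ) :
    HasDerivAt (fun s => symplecticDensity hη p q s a) (symplecticDensityDeriv hη p q t a) t := by
  have d1 : ∀ p : PrePhase η, HasDerivAt (fun s => ((waveFlow hη s p).1 : ℝ → ℝ) a)
      (((waveFlow hη t p).2 : ℝ → ℝ) a) t := fun p =>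
    hasDerivAt_wave (isWavePair_movers p).left (isWavePair_movers p).right t a
  have d2 : ∀ p : PrePhase η, HasDerivAt (fun s => ((waveFlow hη s p).2 : ℝ → ℝ) a)
      (((waveField (waveFlow hη t p)).2 : ℝ → ℝ) a) t := fun p => by
    rw [waveField_waveFlow_snd]
    exact hasDerivAt_wave (isWavePair_movers p).derivs_neg.left
      (isWavePair_movers p).derivs_neg.right t a
  have h := ((d2 p).fun_mul (d1 q)).fun_sub ((d2 q).fun_mul (d1 p))
  -- The two products of velocities cancel, leaving only the accelerations.
  refine h.congr_deriv ?_
  unfold symplecticDensityDeriv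
  ring

/-- An integrable majorant, locally uniform in time, for differentiating under the integral sign. -/
theorem exists_bound_symplecticDensityDeriv {η : ℝ} (hη : 0 < η) (p q : PrePhase η) (T : ℝ) :
    ∃ C : ℝ, ∀ t, |t| ≤ T → ∀ a,
      |symplecticDensityDeriv hη p q t a| ≤ C * (1 + a ^ 2) ^ (-(η + 2 + η) / 2) := by
  have key : ∀ p q : PrePhase η, ∃ C : ℝ, ∀ t, |t| ≤ T → ∀ a,
      |((waveField (waveFlow hη t p)).2 : ℝ → ℝ) a * ((waveFlow hη t q).1 : ℝ → ℝ) a|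
        ≤ C * (1 + a ^ 2) ^ (-(η + 2 + η) / 2) := fun p q => by
    obtain ⟨C₁, h1, hC₁⟩ := (isWavePair_movers p).derivs_neg.derivs_neg.exists_bound_wave
      (by linarith) T
    obtain ⟨C₂, h2, hC₂⟩ := (isWavePair_movers q).exists_bound_wave hη T
    refine ⟨C₁ * C₂, fun t ht a => ?_⟩
    rw [waveField_waveFlow_snd, abs_mul]
    have hpos : (0 : ℝ) < 1 + a ^ 2 := by positivity
    calc _ ≤ (C₁ * (1 + a ^ 2) ^ (-(η + 1 + 1) / 2)) * (C₂ * (1 + a ^ 2) ^ (-η / 2)) :=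
          mul_le_mul (hC₁ t ht a) (hC₂ t ht a) (abs_nonneg _)
            (mul_nonneg h1 (weight_pos _ a).le)
      _ = C₁ * C₂ * (1 + a ^ 2) ^ (-(η + 2 + η) / 2) := by
          rw [show -(η + 2 + η) / 2 = -(η + 1 + 1) / 2 + -η / 2 by ring, Real.rpow_add hpos]
          ring
  obtain ⟨C₁, hC₁⟩ := key p q
  obtain ⟨C₂, hC₂⟩ := key q p
  refine ⟨C₁ + C₂, fun t ht a => ?_⟩
  rw [add_mul]
  exact (abs_sub _ _).trans (add_le_add (hC₁ t ht a) (hC₂ t ht a))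

theorem integral_symplecticDensity {η : ℝ} (hη : 0 < η) (p q : PrePhase η) (t : ℝ) :
    ∫ a, symplecticDensity hη p q t a = ∫ a, symplecticDensity hη p q 0 a := by
  have hint : ∀ t, MeasureTheory.Integrable (symplecticDensity hη p q t) := fun t =>
    (integrable_mul hη (waveFlow hη t p).2 (waveFlow hη t q).1).sub
      (integrable_mul hη (waveFlow hη t q).2 (waveFlow hη t p).1)
  have hd : ∀ t, HasDerivAt (fun s => ∫ a, symplecticDensity hη p q s a) 0 t := fun t => by
    obtain ⟨C, hC⟩ := exists_bound_symplecticDensityDeriv hη p q (|t| + 1)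
    have hb : MeasureTheory.Integrable fun a : ℝ => C * (1 + a ^ 2) ^ (-(η + 2 + η) / 2) := by
      have := integrable_rpow_neg_one_add_norm_sq (E := ℝ) (μ := MeasureTheory.volume)
        (r := η + 2 + η) (by simp; linarith)
      simpa using this.const_mul C
    have hmeas : Continuous (symplecticDensityDeriv hη p q t) :=
      ((waveField (waveFlow hη t p)).2.2.1.continuous.mul (waveFlow hη t q).1.2.1.continuous).sub
        ((waveField (waveFlow hη t q)).2.2.1.continuous.mul (waveFlow hη t p).1.2.1.continuous)
    have h := (hasDerivAt_integral_of_dominated_loc_of_deriv_le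
      (μ := MeasureTheory.volume) (F := symplecticDensity hη p q)
      (F' := symplecticDensityDeriv hη p q) (x₀ := t)
      (Metric.closedBall_mem_nhds t one_pos)
      (Filter.Eventually.of_forall fun s => (hint s).aestronglyMeasurable) (hint t)
      hmeas.aestronglyMeasurable
      (Filter.Eventually.of_forall fun a s hs => hC s (by
        have : |s - t| ≤ 1 := by simpa [Real.dist_eq] using hs
        have e : s = (s - t) + t := by ring
        rw [e]
        linarith [abs_add_le (s - t) t]) a) hb
      (Filter.Eventually.of_forall fun a s _ => hasDerivAt_symplecticDensity hη p q s a)).2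
    have e : ∫ a, symplecticDensityDeriv hη p q t a = 0 :=
      integral_waveField_eq_zero hη (waveFlow hη t p) (waveFlow hη t q)
    rwa [e] at h
  exact is_const_of_deriv_eq_zero (fun s => (hd s).differentiableAt) (fun s => (hd s).deriv) t 0

theorem preForm_waveFlow {η : ℝ} (hη : 0 < η) {τ n : ℝ × ℝ} (hn : n = (τ.2, τ.1))
    (hτ : τ.1 ^ 2 - τ.2 ^ 2 ≠ 0) (t : ℝ) (p q : PrePhase η) :
    preForm η hη τ n (waveFlow hη t p) (waveFlow hη t q) = preForm η hη τ n p q := by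
  have h := integral_symplecticDensity hη p q t
  simp only [symplecticDensity, waveFlow_zero] at h
  rw [preForm_of_conjugate hη hn hτ, preForm_of_conjugate hη hn hτ, h]

/-! ### Geometry of the strip -/

/-- The linear form `(x, y) ↦ c x + d y`. -/
def linForm (c d : ℝ) : ℝ × ℝ →L[ℝ] ℝ :=
  c • ContinuousLinearMap.fst ℝ ℝ ℝ + d • ContinuousLinearMap.snd ℝ ℝ ℝ

theorem linForm_apply (c d : ℝ) (p : ℝ × ℝ) : linForm c d p = c * p.1 + d * p.2 := rfl

/-- The coordinate `s` with respect to the frame `(τ, n)`. -/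
def transversal (τ n : ℝ × ℝ) : ℝ × ℝ →L[ℝ] ℝ := linForm (-τ.2 / area τ n) (τ.1 / area τ n)

/-- The coordinate `a` with respect to the frame `(τ, n)`. -/
def longitudinal (τ n : ℝ × ℝ) : ℝ × ℝ →L[ℝ] ℝ := linForm (n.2 / area τ n) (-n.1 / area τ n)

theorem transversal_apply {τ n : ℝ × ℝ} (h : area τ n ≠ 0) (a s : ℝ) :
    transversal τ n (a • τ + s • n) = s := by
  simp only [area] at h
  simp only [transversal, linForm_apply, area, Prod.fst_add, Prod.snd_add, Prod.smul_fst,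
    Prod.smul_snd, smul_eq_mul]
  field_simp
  ring

theorem longitudinal_apply {τ n : ℝ × ℝ} (h : area τ n ≠ 0) (a s : ℝ) :
    longitudinal τ n (a • τ + s • n) = a := by
  simp only [longitudinal, linForm_apply, Prod.fst_add, Prod.snd_add, Prod.smul_fst,
    Prod.smul_snd, smul_eq_mul]
  rw [div_mul_eq_mul_div, div_mul_eq_mul_div, ← add_div, div_eq_iff h, area]
  ring

theorem eq_longitudinal_add_transversal {τ n : ℝ × ℝ} (h : area τ n ≠ 0) (p : ℝ × ℝ) :
    p = longitudinal τ n p • τ + transversal τ n p • n := by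
  have hA := mul_inv_cancel₀ h
  refine Prod.ext ?_ ?_ <;>
  simp only [transversal, longitudinal, linForm_apply, div_eq_mul_inv, Prod.fst_add,
    Prod.snd_add, Prod.smul_fst, Prod.smul_snd, smul_eq_mul] <;>
  generalize (area τ n)⁻¹ = I at hA ⊢ <;> rw [area] at hA
  · linear_combination -p.1 * hA
  · linear_combination -p.2 * hA

theorem strip_eq_preimage {τ n : ℝ × ℝ} (h : area τ n ≠ 0) (s₀ s₁ : ℝ) :
    strip τ n s₀ s₁ = transversal τ n ⁻¹' Set.Icc s₀ s₁ := by
  ext p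
  constructor
  · rintro ⟨a, s, hs, rfl⟩
    rw [Set.mem_preimage, transversal_apply h]
    exact hs
  · exact fun hp => ⟨_, _, hp, eq_longitudinal_add_transversal h p⟩

theorem mem_strip (τ n : ℝ × ℝ) {s₀ s₁ s : ℝ} (hs : s ∈ Set.Icc s₀ s₁) (a : ℝ) :
    a • τ + s • n ∈ strip τ n s₀ s₁ := ⟨a, s, hs, rfl⟩

theorem convex_strip {τ n : ℝ × ℝ} (h : area τ n ≠ 0) (s₀ s₁ : ℝ) :
    Convex ℝ (strip τ n s₀ s₁) := by
  rw [strip_eq_preimage h]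
  exact (convex_Icc s₀ s₁).is_linear_preimage (transversal τ n).isLinear

theorem nonempty_interior_strip {τ n : ℝ × ℝ} (h : area τ n ≠ 0) {s₀ s₁ : ℝ} (hs : s₀ < s₁) :
    (interior (strip τ n s₀ s₁)).Nonempty := by
  obtain ⟨s, hs⟩ := exists_between hs
  refine ⟨(0 : ℝ) • τ + s • n, interior_maximal (t := transversal τ n ⁻¹' Set.Ioo s₀ s₁) ?_
    (isOpen_Ioo.preimage (transversal τ n).continuous) ?_⟩
  · rw [strip_eq_preimage h]
    exact Set.preimage_mono Set.Ioo_subset_Icc_self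
  · rw [Set.mem_preimage, transversal_apply h]
    exact hs

theorem uniqueDiffOn_strip {τ n : ℝ × ℝ} (h : area τ n ≠ 0) {s₀ s₁ : ℝ} (hs : s₀ < s₁) :
    UniqueDiffOn ℝ (strip τ n s₀ s₁) :=
  uniqueDiffOn_convex (convex_strip h s₀ s₁) (nonempty_interior_strip h hs)

/-- The strip has bounded width, so decay in the parameter `a` gives decay in the plane. The
constant comes from `(u + v)² ≤ 2u² + 2v²`. -/
theorem one_add_norm_sq_le_of_mem_strip (τ n : ℝ × ℝ) (s₀ s₁ : ℝ) :
    ∃ K T : ℝ, 0 < K ∧ ∀ a, ∀ s ∈ Set.Icc s₀ s₁, |s| ≤ T ∧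
      1 + (a • τ + s • n).1 ^ 2 + (a • τ + s • n).2 ^ 2 ≤ K * (1 + a ^ 2) := by
  refine ⟨1 + 2 * (τ.1 ^ 2 + τ.2 ^ 2) + 2 * (|s₀| + |s₁|) ^ 2 * (n.1 ^ 2 + n.2 ^ 2),
    |s₀| + |s₁|, by positivity, fun a s hs => ?_⟩
  have h1 : |s| ≤ |s₀| + |s₁| := by
    have h2 := abs_nonneg s₀
    have h3 := abs_nonneg s₁
    exact abs_le.2 ⟨by linarith [hs.1, neg_abs_le s₀], by linarith [hs.2, le_abs_self s₁]⟩
  refine ⟨h1, ?_⟩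
  have h4 : s ^ 2 ≤ (|s₀| + |s₁|) ^ 2 := by
    rw [← sq_abs s]
    exact pow_le_pow_left₀ (abs_nonneg s) h1 2
  generalize |s₀| + |s₁| = T at h4
  have h5 : ∀ x u : ℝ, (a * x + s * u) ^ 2 ≤ 2 * a ^ 2 * x ^ 2 + 2 * T ^ 2 * u ^ 2 := fun x u => by
    nlinarith [sq_nonneg (a * x - s * u), mul_le_mul_of_nonneg_right h4 (sq_nonneg u)]
  have h6 := h5 τ.1 n.1
  have h7 := h5 τ.2 n.2
  simp only [Prod.fst_add, Prod.snd_add, Prod.smul_fst, Prod.smul_snd, smul_eq_mul]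
  have h8 : 0 ≤ a ^ 2 + 2 * (τ.1 ^ 2 + τ.2 ^ 2) + 2 * T ^ 2 * (n.1 ^ 2 + n.2 ^ 2) * a ^ 2 := by
    positivity
  nlinarith

/-! ### Fields that are superpositions of plane waves -/

section Superposition

variable {F G : ℝ → ℝ} (ℓ₁ ℓ₂ : ℝ × ℝ →L[ℝ] ℝ)

theorem contDiff_comp_linear {F : ℝ → ℝ} (hF : ContDiff ℝ ∞ F) (ℓ : ℝ × ℝ →L[ℝ] ℝ) :
    ContDiff ℝ ∞ (F ∘ ℓ) := hF.comp ℓ.contDiff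

theorem iteratedFDerivWithin_superposition {D : Set (ℝ × ℝ)} (hD : UniqueDiffOn ℝ D)
    (hF : ContDiff ℝ ∞ F) (hG : ContDiff ℝ ∞ G) (k : ℕ) {p : ℝ × ℝ} (hp : p ∈ D) :
    iteratedFDerivWithin ℝ k (fun p => F (ℓ₁ p) + G (ℓ₂ p)) D p =
      (iteratedFDeriv ℝ k F (ℓ₁ p)).compContinuousLinearMap (fun _ => ℓ₁)
        + (iteratedFDeriv ℝ k G (ℓ₂ p)).compContinuousLinearMap (fun _ => ℓ₂) := by
  have hk : (k : WithTop ℕ∞) ≤ ∞ := by exact_mod_cast le_top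
  have h1 := (contDiff_comp_linear hF ℓ₁).of_le hk
  have h2 := (contDiff_comp_linear hG ℓ₂).of_le hk
  have h3 : ContDiff ℝ k (F ∘ ℓ₁ + G ∘ ℓ₂) := h1.add h2
  change iteratedFDerivWithin ℝ k (F ∘ ℓ₁ + G ∘ ℓ₂) D p = _
  rw [iteratedFDerivWithin_eq_iteratedFDeriv hD h3.contDiffAt hp,
    iteratedFDeriv_add_apply h1.contDiffAt h2.contDiffAt,
    ℓ₁.iteratedFDeriv_comp_right hF p hk, ℓ₂.iteratedFDeriv_comp_right hG p hk]

theorem norm_iteratedFDeriv_comp_linear_le (F : ℝ → ℝ) (ℓ : ℝ × ℝ →L[ℝ] ℝ) (k : ℕ) (p : ℝ × ℝ) :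
    ‖(iteratedFDeriv ℝ k F (ℓ p)).compContinuousLinearMap (fun _ => ℓ)‖ ≤
      ‖ℓ‖ ^ k * |iteratedDeriv k F (ℓ p)| := by
  refine (ContinuousMultilinearMap.norm_compContinuousLinearMap_le _ _).trans (le_of_eq ?_)
  rw [norm_iteratedFDeriv_eq_norm_iteratedDeriv, Real.norm_eq_abs, mul_comm]
  simp

/-- The parameter `a` is a reference point close to both arguments. As on the line, order `0` uses
the decay of the sum and higher orders that of each profile. -/
theorem isField_superposition {η : ℝ} (hη : 0 < η) {D : Set (ℝ × ℝ)} (hD : UniqueDiffOn ℝ D)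
    (hw : IsWavePair η F G) {K T : ℝ} (hK : 0 < K)
    (h : ∀ p ∈ D, ∃ a, |ℓ₁ p - a| ≤ T ∧ |ℓ₂ p - a| ≤ T ∧
      1 + p.1 ^ 2 + p.2 ^ 2 ≤ K * (1 + a ^ 2)) :
    IsField η D (fun p => F (ℓ₁ p) + G (ℓ₂ p)) := by
  refine ⟨((contDiff_comp_linear hw.left ℓ₁).add
    (contDiff_comp_linear hw.right ℓ₂)).contDiffOn, fun k => ?_⟩
  have hr : 0 ≤ η + k := by positivity
  suffices hs : ∃ C : ℝ, 0 ≤ C ∧ ∀ p ∈ D, ∀ a, |ℓ₁ p - a| ≤ T → |ℓ₂ p - a| ≤ T →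
      ‖iteratedFDerivWithin ℝ k (fun p => F (ℓ₁ p) + G (ℓ₂ p)) D p‖
        ≤ C * (1 + a ^ 2) ^ (-(η + k) / 2) by
    obtain ⟨C, hC0, hC⟩ := hs
    refine ⟨C * K ^ ((η + k) / 2), fun p hp => ?_⟩
    obtain ⟨a, h1, h2, h3⟩ := h p hp
    refine (hC p hp a h1 h2).trans ?_
    rw [mul_assoc]
    exact mul_le_mul_of_nonneg_left (rpow_neg_le_of_le_mul hr hK (by positivity) h3) hC0
  cases k with
  | zero =>
    obtain ⟨C, hC0, hC⟩ := hw.exists_bound_add hη T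
    refine ⟨C, hC0, fun p _ a h1 h2 => ?_⟩
    simpa using hC a _ _ h1 h2
  | succ k =>
    have hk : 0 ≤ η + 1 + k := by positivity
    obtain ⟨C₁, hC₁0, hC₁⟩ := exists_bound_near hk (hw.deriv_left.2 k) T
    obtain ⟨C₂, hC₂0, hC₂⟩ := exists_bound_near hk (hw.deriv_right.2 k) T
    refine ⟨‖ℓ₁‖ ^ (k + 1) * C₁ + ‖ℓ₂‖ ^ (k + 1) * C₂, by positivity, fun p hp a h1 h2 => ?_⟩
    rw [iteratedFDerivWithin_superposition ℓ₁ ℓ₂ hD hw.left hw.right _ hp, add_mul]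
    push_cast
    rw [show η + ((k : ℝ) + 1) = η + 1 + k by ring, mul_assoc, mul_assoc]
    refine (norm_add_le _ _).trans (add_le_add ?_ ?_)
    · refine (norm_iteratedFDeriv_comp_linear_le _ _ _ _).trans ?_
      rw [iteratedDeriv_succ']
      exact mul_le_mul_of_nonneg_left (hC₁ a _ h1) (by positivity)
    · refine (norm_iteratedFDeriv_comp_linear_le _ _ _ _).trans ?_
      rw [iteratedDeriv_succ']
      exact mul_le_mul_of_nonneg_left (hC₂ a _ h2) (by positivity)

/-- The wave operator sends `F ∘ ℓ` to `F''` times the Minkowski square of the covector `ℓ`; `h1`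
and `h2` say that both covectors are null. -/
theorem solvesWaveEquation_superposition {D : Set (ℝ × ℝ)} (hD : UniqueDiffOn ℝ D)
    (hF : ContDiff ℝ ∞ F) (hG : ContDiff ℝ ∞ G) (h1 : ℓ₁ (1, 0) ^ 2 = ℓ₁ (0, 1) ^ 2)
    (h2 : ℓ₂ (1, 0) ^ 2 = ℓ₂ (0, 1) ^ 2) :
    SolvesWaveEquation D (fun p => F (ℓ₁ p) + G (ℓ₂ p)) := by
  intro p hp
  rw [iteratedFDerivWithin_superposition ℓ₁ ℓ₂ hD hF hG 2 hp]
  simp only [add_apply,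
    ContinuousMultilinearMap.compContinuousLinearMap_apply,
    iteratedFDeriv_apply_eq_iteratedDeriv_mul_prod, Finset.prod_const, Finset.card_univ,
    Fintype.card_fin, h1, h2, sub_self]

theorem fderivWithin_superposition {D : Set (ℝ × ℝ)} (hD : UniqueDiffOn ℝ D)
    (hF : ContDiff ℝ ∞ F) (hG : ContDiff ℝ ∞ G) {p : ℝ × ℝ} (hp : p ∈ D) (v : ℝ × ℝ) :
    fderivWithin ℝ (fun p => F (ℓ₁ p) + G (ℓ₂ p)) D p v =
      deriv F (ℓ₁ p) * ℓ₁ v + deriv G (ℓ₂ p) * ℓ₂ v := by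
  have h1 := (hF.differentiable (by simp) (ℓ₁ p)).hasDerivAt.comp_hasFDerivAt p ℓ₁.hasFDerivAt
  have h2 := (hG.differentiable (by simp) (ℓ₂ p)).hasDerivAt.comp_hasFDerivAt p ℓ₂.hasFDerivAt
  have h3 := (h1.add h2).hasFDerivWithinAt.fderivWithin (hD p hp)
  change fderivWithin ℝ (F ∘ ℓ₁ + G ∘ ℓ₂) D p v = _
  rw [h3]
  simp

end Superposition

/-! ### Propagation along characteristics -/

/-- The mixed second derivatives of a solution vanish for pairs of directions whose symmetric
product is proportional to the inverse metric. -/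
theorem fderivWithin_fderivWithin_eq_zero {D : Set (ℝ × ℝ)} (hD : UniqueDiffOn ℝ D)
    (hcl : D ⊆ closure (interior D)) {φ : ℝ × ℝ → ℝ} (hφ : ContDiffOn ℝ ∞ φ D)
    (hw : SolvesWaveEquation D φ) {d e : ℝ × ℝ} (h1 : d.1 * e.1 + d.2 * e.2 = 0)
    (h2 : d.1 * e.2 + d.2 * e.1 = 0) {q : ℝ × ℝ} (hq : q ∈ D) :
    fderivWithin ℝ (fderivWithin ℝ φ D) D q d e = 0 := by
  -- Symmetry also holds at boundary points, because these are limits of interior points.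
  have hsymm : IsSymmSndFDerivWithinAt ℝ φ D q :=
    (hφ q hq).isSymmSndFDerivWithinAt (by
      rw [minSmoothness_of_isRCLikeNormedField]
      exact WithTop.coe_le_coe.2 le_top) hD (hcl hq) hq
  have hb := hsymm.eq (1, 0) (0, 1)
  have hc := hw q hq
  rw [iteratedFDerivWithin_two_apply φ hD hq, iteratedFDerivWithin_two_apply φ hD hq] at hc
  have hsplit : ∀ v : ℝ × ℝ, v = v.1 • ((1, 0) : ℝ × ℝ) + v.2 • ((0, 1) : ℝ × ℝ) := fun v =>
    Prod.ext (by simp) (by simp)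
  rw [hsplit d, hsplit e]
  simp only [map_add, map_smul, add_apply, smul_apply,
    smul_eq_mul] at hb hc ⊢
  -- With `φ_xx = φ_yy` and `φ_xy = φ_yx` the second derivative is `φ_xx` times the left side of
  -- `h1` plus `φ_xy` times that of `h2`.
  linear_combination fderivWithin ℝ (fderivWithin ℝ φ D) D q (1, 0) (1, 0) * h1
    + fderivWithin ℝ (fderivWithin ℝ φ D) D q (1, 0) (0, 1) * h2 - d.2 * e.1 * hb - d.2 * e.2 * hc

/-- Convexity keeps the segment in `D`, where the mean value inequality applies with constant `0`.
-/
theorem fderivWithin_eq_along {D : Set (ℝ × ℝ)} (hD : UniqueDiffOn ℝ D) (hconv : Convex ℝ D)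
    {φ : ℝ × ℝ → ℝ} (hφ : ContDiffOn ℝ ∞ φ D) {d e : ℝ × ℝ}
    (h : ∀ q ∈ D, fderivWithin ℝ (fderivWithin ℝ φ D) D q d e = 0) {q : ℝ × ℝ} {c : ℝ}
    (hq : q ∈ D) (hq' : q + c • d ∈ D) :
    fderivWithin ℝ φ D (q + c • d) e = fderivWithin ℝ φ D q e := by
  have hdiff : DifferentiableOn ℝ (fderivWithin ℝ φ D) D :=
    ((contDiffOn_infty_iff_fderivWithin hD).1 hφ).2.differentiableOn (by simp)
  have hmaps : Set.MapsTo (fun t : ℝ => q + t • (c • d)) (Set.Icc 0 1) D := fun t ht => by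
    have := hconv hq hq' (a := 1 - t) (b := t) (by linarith [ht.2]) ht.1 (by ring)
    convert this using 1
    module
  have hder : ∀ t ∈ Set.Icc (0 : ℝ) 1, HasDerivWithinAt
      (fun t : ℝ => fderivWithin ℝ φ D (q + t • (c • d)) e) 0 (Set.Icc 0 1) t := fun t ht => by
    have hg : HasDerivWithinAt (fun t : ℝ => q + t • (c • d)) (c • d) (Set.Icc 0 1) t := by
      simpa using (((hasDerivAt_id' t).smul_const (c • d)).const_add q).hasDerivWithinAt
    have h1 := ((hdiff _ (hmaps ht)).hasFDerivWithinAt.clm_apply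
      (hasFDerivWithinAt_const e _ _)).comp_hasDerivWithinAt t hg hmaps
    refine h1.congr_deriv ?_
    simp [h _ (hmaps ht)]
  have := (convex_Icc (0 : ℝ) 1).norm_image_sub_le_of_norm_hasDerivWithin_le (C := 0) hder
    (fun _ _ => by simp) (Set.left_mem_Icc.2 zero_le_one) (Set.right_mem_Icc.2 zero_le_one)
  simp only [one_smul, zero_smul, add_zero, zero_mul] at this
  exact sub_eq_zero.1 (norm_le_zero_iff.1 this)

theorem IsBoundaryValue.deriv_fst {η : ℝ} {τ n : ℝ × ℝ} {s₀ s₁ s : ℝ}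
    (hs : s ∈ Set.Icc s₀ s₁) {φ : ℝ × ℝ → ℝ}
    (hφ : DifferentiableOn ℝ φ (strip τ n s₀ s₁)) {p : PrePhase η}
    (hp : IsBoundaryValue (strip τ n s₀ s₁) τ n s φ p) (a : ℝ) :
    deriv (p.1 : ℝ → ℝ) a = fderivWithin ℝ φ (strip τ n s₀ s₁) (a • τ + s • n) τ := by
  have e : (p.1 : ℝ → ℝ) = φ ∘ fun a : ℝ => a • τ + s • n := funext fun a => (hp a).1
  have hg : HasDerivWithinAt (fun a : ℝ => a • τ + s • n) τ Set.univ a := by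
    have h := ((hasDerivAt_id' a).smul_const τ).add_const (s • n)
    rw [one_smul] at h
    exact h.hasDerivWithinAt
  have h := (hφ _ (mem_strip τ n hs a)).hasFDerivWithinAt.comp_hasDerivWithinAt a hg
    (fun b _ => mem_strip τ n hs b)
  rw [e]
  exact (hasDerivWithinAt_univ.1 h).deriv

theorem strip_subset_closure_interior {τ n : ℝ × ℝ} (h : area τ n ≠ 0) {s₀ s₁ : ℝ}
    (hs : s₀ < s₁) : strip τ n s₀ s₁ ⊆ closure (interior (strip τ n s₀ s₁)) := by
  rw [(convex_strip h s₀ s₁).closure_interior_eq_closure_of_nonempty_interior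
    (nonempty_interior_strip h hs)]
  exact subset_closure

/-- For a solution, `∂_e φ` is the same at both ends of a segment in the direction `d`. -/
theorem fderivWithin_strip_eq_along {τ n : ℝ × ℝ} (h : area τ n ≠ 0) {s₀ s₁ : ℝ}
    (hs : s₀ < s₁) {φ : ℝ × ℝ → ℝ} (hφ : ContDiffOn ℝ ∞ φ (strip τ n s₀ s₁))
    (hw : SolvesWaveEquation (strip τ n s₀ s₁) φ) {d e : ℝ × ℝ}
    (h1 : d.1 * e.1 + d.2 * e.2 = 0) (h2 : d.1 * e.2 + d.2 * e.1 = 0) {q : ℝ × ℝ} {c : ℝ}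
    (hq : q ∈ strip τ n s₀ s₁) (hq' : q + c • d ∈ strip τ n s₀ s₁) :
    fderivWithin ℝ φ (strip τ n s₀ s₁) (q + c • d) e =
      fderivWithin ℝ φ (strip τ n s₀ s₁) q e :=
  fderivWithin_eq_along (uniqueDiffOn_strip h hs) (convex_strip h s₀ s₁) hφ
    (fun _ hq => fderivWithin_fderivWithin_eq_zero (uniqueDiffOn_strip h hs)
      (strip_subset_closure_interior h hs) hφ hw h1 h2 hq) hq hq'

/-! ### Space-like and time-like strips -/

/-- Both null directions `n ± τ` cross the strip. Transport along them expresses `π + φ'` and `π -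
φ'` at `s₁` by shifted values at `s₀`; these determine `π` and `φ'`, and decay determines `φ`. -/
theorem eq_waveFlow_of_isBoundaryValue {η : ℝ} (hη : 0 < η) {τ n : ℝ × ℝ} (hn : n = (τ.2, τ.1))
    (hA : area τ n ≠ 0) {s₀ s₁ : ℝ} (hs : s₀ < s₁) {φ : ℝ × ℝ → ℝ}
    (hφ : ContDiffOn ℝ ∞ φ (strip τ n s₀ s₁)) (hw : SolvesWaveEquation (strip τ n s₀ s₁) φ)
    {p₀ p₁ : PrePhase η} (h₀ : IsBoundaryValue (strip τ n s₀ s₁) τ n s₀ φ p₀)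
    (h₁ : IsBoundaryValue (strip τ n s₀ s₁) τ n s₁ φ p₁) :
    p₁ = waveFlow hη (s₁ - s₀) p₀ := by
  have m₀ := Set.left_mem_Icc.2 hs.le
  have m₁ := Set.right_mem_Icc.2 hs.le
  have hd := hφ.differentiableOn (by simp)
  have left : ∀ a, (p₁.2 : ℝ → ℝ) a + deriv (p₁.1 : ℝ → ℝ) a =
      (p₀.2 : ℝ → ℝ) (a + (s₁ - s₀)) + deriv (p₀.1 : ℝ → ℝ) (a + (s₁ - s₀)) := fun a => by
    have e : (a + (s₁ - s₀)) • τ + s₀ • n + (s₁ - s₀) • (n - τ) = a • τ + s₁ • n := by module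
    have h := fderivWithin_strip_eq_along hA hs hφ hw (d := n - τ) (e := n + τ) (c := s₁ - s₀)
      (by subst hn; simp only [Prod.fst_sub, Prod.snd_sub, Prod.fst_add, Prod.snd_add]; ring)
      (by subst hn; simp only [Prod.fst_sub, Prod.snd_sub, Prod.fst_add, Prod.snd_add]; ring)
      (mem_strip τ n m₀ (a + (s₁ - s₀))) (by rw [e]; exact mem_strip τ n m₁ a)
    rw [e, map_add, map_add] at h
    rw [h₁.deriv_fst m₁ hd, h₀.deriv_fst m₀ hd, (h₁ a).2, (h₀ _).2, h]
  have right : ∀ a, (p₁.2 : ℝ → ℝ) a - deriv (p₁.1 : ℝ → ℝ) a =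
      (p₀.2 : ℝ → ℝ) (a - (s₁ - s₀)) - deriv (p₀.1 : ℝ → ℝ) (a - (s₁ - s₀)) := fun a => by
    have e : (a - (s₁ - s₀)) • τ + s₀ • n + (s₁ - s₀) • (n + τ) = a • τ + s₁ • n := by module
    have h := fderivWithin_strip_eq_along hA hs hφ hw (d := n + τ) (e := n - τ) (c := s₁ - s₀)
      (by subst hn; simp only [Prod.fst_sub, Prod.snd_sub, Prod.fst_add, Prod.snd_add]; ring)
      (by subst hn; simp only [Prod.fst_sub, Prod.snd_sub, Prod.fst_add, Prod.snd_add]; ring)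
      (mem_strip τ n m₀ (a - (s₁ - s₀))) (by rw [e]; exact mem_strip τ n m₁ a)
    rw [e, map_sub, map_sub] at h
    rw [h₁.deriv_fst m₁ hd, h₀.deriv_fst m₀ hd, (h₁ a).2, (h₀ _).2, h]
  have hp := isWavePair_movers p₀
  refine prePhase_ext (eq_of_deriv_eq hη p₁.1.2 (waveFlow hη _ p₀).1.2 fun a => ?_)
    (funext fun a => ?_)
  · change _ = deriv (wave (leftMover p₀) (rightMover p₀) (s₁ - s₀)) a
    rw [deriv_wave hp.left hp.right, deriv_leftMover, deriv_rightMover]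
    simp only [wave, Pi.smul_apply, Pi.add_apply, Pi.sub_apply, smul_eq_mul]
    linarith [left a, right a]
  · change _ = wave (deriv (leftMover p₀)) (-deriv (rightMover p₀)) (s₁ - s₀) a
    rw [deriv_leftMover, deriv_rightMover]
    simp only [wave, Pi.neg_apply, Pi.smul_apply, Pi.add_apply, Pi.sub_apply, smul_eq_mul]
    linarith [left a, right a]

/-- Every orbit of the flow is the family of boundary values of a solution on the strip. -/
theorem exists_field_of_waveFlow {η : ℝ} (hη : 0 < η) {τ n : ℝ × ℝ} (hn : n = (τ.2, τ.1))
    (hA : area τ n ≠ 0) {s₀ s₁ : ℝ} (hs : s₀ < s₁) (p : PrePhase η) :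
    ∃ φ, IsField η (strip τ n s₀ s₁) φ ∧ SolvesWaveEquation (strip τ n s₀ s₁) φ ∧
      ∀ s ∈ Set.Icc s₀ s₁, IsBoundaryValue (strip τ n s₀ s₁) τ n s φ (waveFlow hη s p) := by
  have hp := isWavePair_movers p
  have hD := uniqueDiffOn_strip hA hs
  set ℓ₁ := longitudinal τ n + transversal τ n with hℓ₁
  set ℓ₂ := longitudinal τ n - transversal τ n with hℓ₂
  have e₁ : ∀ a s : ℝ, ℓ₁ (a • τ + s • n) = a + s := fun a s => by
    rw [hℓ₁, add_apply, longitudinal_apply hA, transversal_apply hA]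
  have e₂ : ∀ a s : ℝ, ℓ₂ (a • τ + s • n) = a - s := fun a s => by
    rw [hℓ₂, sub_apply, longitudinal_apply hA, transversal_apply hA]
  obtain ⟨K, T, hK, hKT⟩ := one_add_norm_sq_le_of_mem_strip τ n s₀ s₁
  refine ⟨fun q => leftMover p (ℓ₁ q) + rightMover p (ℓ₂ q),
    isField_superposition ℓ₁ ℓ₂ hη hD hp hK (T := T) ?_,
    solvesWaveEquation_superposition ℓ₁ ℓ₂ hD hp.left hp.right ?_ ?_, fun s hs a => ⟨?_, ?_⟩⟩
  · rintro q ⟨a, s, hs', rfl⟩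
    obtain ⟨h1, h2⟩ := hKT a s hs'
    exact ⟨a, by rw [e₁]; simpa using h1, by rw [e₂]; simpa using h1, h2⟩
  · subst hn
    simp only [hℓ₁, add_apply, longitudinal, transversal, linForm_apply]
    ring
  · subst hn
    simp only [hℓ₂, sub_apply, longitudinal, transversal, linForm_apply]
    ring
  · simp only [e₁, e₂]
    rfl
  · change deriv (leftMover p) (a + s) + -deriv (rightMover p) (a - s) = _
    -- The point `0 • τ + 1 • n` is `n` itself, so `ℓ₁ n = 1` and `ℓ₂ n = -1`; the latter gives the
    -- sign of the right-moving velocity.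
    have f₁ := e₁ 0 1
    have f₂ := e₂ 0 1
    rw [zero_smul, one_smul, zero_add] at f₁ f₂
    rw [fderivWithin_superposition ℓ₁ ℓ₂ hD hp.left hp.right (mem_strip τ n hs a), e₁, e₂, f₁, f₂]
    ring

theorem evolutionRelation_of_conjugate {η : ℝ} (hη : 0 < η) {τ n : ℝ × ℝ} (hn : n = (τ.2, τ.1))
    (hA : area τ n ≠ 0) {s₀ s₁ : ℝ} (hs : s₀ < s₁) :
    evolutionRelation η hη τ n s₀ s₁ = Set.range fun p : PrePhase η =>
      (toPhase η hη τ n p, toPhase η hη τ n (waveFlow hη (s₁ - s₀) p)) := by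
  ext z
  constructor
  · rintro ⟨φ, hφ, hw, p₀, p₁, h₀, h₁, rfl⟩
    exact ⟨p₀, by rw [eq_waveFlow_of_isBoundaryValue hη hn hA hs hφ.smooth hw h₀ h₁]⟩
  · rintro ⟨p, rfl⟩
    -- The field is labelled by its state at `s = 0`, so the data at `s₀` are first moved back by
    -- `-s₀`.
    obtain ⟨φ, hφ, hw, hb⟩ := exists_field_of_waveFlow hη hn hA hs (waveFlow hη (-s₀) p)
    have b₀ := hb s₀ (Set.left_mem_Icc.2 hs.le)
    have b₁ := hb s₁ (Set.right_mem_Icc.2 hs.le)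
    rw [← waveFlow_add, add_neg_cancel, waveFlow_zero] at b₀
    rw [← waveFlow_add, ← sub_eq_add_neg] at b₁
    exact ⟨φ, hφ, hw, _, _, b₀, b₁, rfl⟩

/-! ### Lagrangian subspaces -/

theorem toPhase_surjective (η : ℝ) (hη : 0 < η) (τ n : ℝ × ℝ) :
    Function.Surjective (toPhase η hη τ n) := Submodule.mkQ_surjective _

theorem toPhase_eq_iff {η : ℝ} (hη : 0 < η) {τ n : ℝ × ℝ} (p q : PrePhase η) :
    toPhase η hη τ n p = toPhase η hη τ n q ↔ p - q ∈ LinearMap.ker (preForm η hη τ n) :=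
  Submodule.Quotient.eq _

/-- Dividing by the kernel removes exactly the degeneracy of `ω̃`. -/
theorem phaseForm_nondegenerate {η : ℝ} (hη : 0 < η) {τ n : ℝ × ℝ} {x y : Phase η hη τ n}
    (h : ∀ w, phaseForm η hη τ n x w = phaseForm η hη τ n y w) : x = y := by
  obtain ⟨p, rfl⟩ := toPhase_surjective η hη τ n x
  obtain ⟨q, rfl⟩ := toPhase_surjective η hη τ n y
  rw [toPhase_eq_iff, LinearMap.mem_ker]
  refine LinearMap.ext fun r => ?_
  have := h (toPhase η hη τ n r)
  rw [phaseForm_toPhase, phaseForm_toPhase] at this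
  rw [map_sub, LinearMap.sub_apply, this, sub_self]
  rfl

theorem isLagrangian_diagonal {η : ℝ} (hη : 0 < η) (τ n : ℝ × ℝ) :
    IsLagrangian (stripForm η hη τ n) {z | z.1 = z.2} := by
  ext z
  constructor
  · intro hz w hw
    rw [Set.mem_ofPred_eq] at hz hw
    rw [stripForm, hz, hw, sub_self]
  · intro hz
    -- Orthogonality to `(w, w)` says that both components of `z` pair equally with `w`.
    exact (phaseForm_nondegenerate hη fun w => sub_eq_zero.1 (hz (w, w) rfl)).symm

theorem isLagrangian_graph_waveFlow {η : ℝ} (hη : 0 < η) {τ n : ℝ × ℝ} (hn : n = (τ.2, τ.1))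
    (hτ : τ.1 ^ 2 - τ.2 ^ 2 ≠ 0) (t : ℝ) :
    IsLagrangian (stripForm η hη τ n) (Set.range fun p : PrePhase η =>
      (toPhase η hη τ n p, toPhase η hη τ n (waveFlow hη t p))) := by
  ext ⟨x, y⟩
  constructor
  · rintro ⟨p, hp⟩ _ ⟨q, rfl⟩
    obtain ⟨rfl, rfl⟩ := Prod.ext_iff.1 hp
    simp only [stripForm, phaseForm_toPhase, preForm_waveFlow hη hn hτ, sub_self]
  · intro hz
    obtain ⟨p, rfl⟩ := toPhase_surjective η hη τ n x
    refine ⟨p, Prod.ext rfl ?_⟩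
    refine phaseForm_nondegenerate hη fun w => ?_
    obtain ⟨q, rfl⟩ := toPhase_surjective η hη τ n w
    -- Since the flow is invertible, this point of the graph has the arbitrary `q` as its second
    -- component.
    have h := hz _ ⟨waveFlow hη (-t) q, rfl⟩
    simp only [stripForm] at h
    rw [← waveFlow_add, add_neg_cancel, waveFlow_zero, phaseForm_toPhase,
      ← preForm_waveFlow hη hn hτ t, ← waveFlow_add, add_neg_cancel, waveFlow_zero] at h
    rw [phaseForm_toPhase]
    linarith

/-! ### Light-like strips -/

/-- The covector annihilating a null vector `τ` is null, so `Γ = 0`. The remaining coefficient is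
`-g(τ,n)` over the area. -/
theorem IsLightlikeFrame.bdry {τ n : ℝ × ℝ} (h : IsLightlikeFrame τ n) :
    bdryGamma τ n = 0 ∧ bdryDensity τ n * bdryDrift τ n ≠ 0 := by
  obtain ⟨x, y⟩ := τ
  obtain ⟨u, v⟩ := n
  obtain ⟨h1, h2, h3⟩ := h
  simp only [mink, area] at h1 h2 h3
  have hΓ : bdryGamma (x, y) (u, v) = 0 := by
    simp only [bdryGamma, raisedConormal, conormal, area]
    field_simp
    linear_combination -h1
  refine ⟨hΓ, ?_⟩
  have h4 : u * y - v * x ≠ 0 := fun h => h3 (by linarith)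
  -- For null `τ` the Gram identity reduces to `area² = g(τ,n)²`, so independence excludes `g(τ,n) =
  -- 0`.
  have h5 : u * x - v * y ≠ 0 := fun h => h3 (by
    have : (x * v - y * u) ^ 2 = 0 := by
      linear_combination (u * x - v * y) * h - (u * u - v * v) * h1
    exact pow_eq_zero_iff two_ne_zero |>.1 this)
  have e : bdryDensity (x, y) (u, v) * bdryDrift (x, y) (u, v)
      = -(u * x - v * y) / (x * v - y * u) := by
    rw [bdryDrift, hΓ]
    simp only [bdryDensity, raisedConormal, conormal, area, zero_smul, sub_zero]
    field_simp
    ring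
  rw [e]
  exact div_ne_zero (neg_ne_zero.2 h5) h3

/-- With `Γ = 0` only the drift term survives; it is antisymmetric by parts, so antisymmetrising
doubles it. -/
theorem IsLightlikeFrame.preForm_apply {η : ℝ} (hη : 0 < η) {τ n : ℝ × ℝ}
    (h : IsLightlikeFrame τ n) (p q : PrePhase η) :
    preForm η hη τ n p q = 2 * (bdryDensity τ n * bdryDrift τ n) *
      ∫ a, deriv (p.1 : ℝ → ℝ) a * (q.1 : ℝ → ℝ) a := by
  have hparts : ∫ a, deriv (q.1 : ℝ → ℝ) a * (p.1 : ℝ → ℝ) a =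
      -∫ a, deriv (p.1 : ℝ → ℝ) a * (q.1 : ℝ → ℝ) a := by
    have h1 : MeasureTheory.Integrable fun a => (q.1 : ℝ → ℝ) a * deriv (p.1 : ℝ → ℝ) a := by
      simpa only [mul_comm] using integrable_deriv_mul hη p.1 q.1
    -- The product of two boundary values decays only with order `2η` and need not be integrable for
    -- small `η`, so the boundary terms are handled as limits.
    have hlim : ∀ l : Filter ℝ, Filter.Tendsto (fun a : ℝ => a ^ 2) l Filter.atTop →
        Filter.Tendsto ((q.1 : ℝ → ℝ) * (p.1 : ℝ → ℝ)) l (𝓝 0) := fun l hl => by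
      have h := (tendsto_zero_of_mem hη q.1.2 hl).mul (tendsto_zero_of_mem hη p.1.2 hl)
      rwa [mul_zero] at h
    have h2 := MeasureTheory.integral_mul_deriv_eq_deriv_mul
      (u := (q.1 : ℝ → ℝ)) (v := (p.1 : ℝ → ℝ))
      (fun x _ => (differentiable_of_mem q.1 x).hasDerivAt)
      (fun x _ => (differentiable_of_mem p.1 x).hasDerivAt) h1 (integrable_deriv_mul hη q.1 p.1)
      (hlim _ (((Filter.tendsto_pow_atTop two_ne_zero).comp
        Filter.tendsto_neg_atBot_atTop).congr fun a => neg_sq a))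
      (hlim _ (Filter.tendsto_pow_atTop two_ne_zero))
    simp only [mul_comm (deriv (p.1 : ℝ → ℝ) _)]
    linarith
  rw [MinkowskiStrip.preForm_apply, h.bdry.1]
  simp only [zero_mul, zero_add, mul_assoc]
  rw [MeasureTheory.integral_const_mul, MeasureTheory.integral_const_mul, hparts]
  ring

theorem IsLightlikeFrame.mem_ker_iff {η : ℝ} (hη : 0 < η) {τ n : ℝ × ℝ}
    (h : IsLightlikeFrame τ n) (p : PrePhase η) :
    p ∈ LinearMap.ker (preForm η hη τ n) ↔ p.1 = 0 := by
  rw [LinearMap.mem_ker]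
  constructor
  · intro hp
    have h1 : deriv (p.1 : ℝ → ℝ) = 0 :=
      eq_zero_of_forall_integral_mul (deriv_mem_decaySpace p.1.2).1.continuous fun g hg hc => by
        have h2 := h.preForm_apply hη p (⟨g, mem_decaySpace_of_hasCompactSupport _ hg hc⟩, 0)
        rw [hp, LinearMap.zero_apply, eq_comm, mul_eq_zero] at h2
        have h3 := h2.resolve_left (mul_ne_zero two_ne_zero h.bdry.2)
        simpa only [mul_comm] using h3
    exact Subtype.ext (eq_zero_of_deriv_eq_zero hη p.1.2 fun a => congrFun h1 a)
  · intro hp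
    refine LinearMap.ext fun q => ?_
    rw [h.preForm_apply, hp]
    simp

theorem IsLightlikeFrame.toPhase_eq_iff {η : ℝ} (hη : 0 < η) {τ n : ℝ × ℝ}
    (h : IsLightlikeFrame τ n) (p q : PrePhase η) :
    toPhase η hη τ n p = toPhase η hη τ n q ↔ p.1 = q.1 := by
  rw [MinkowskiStrip.toPhase_eq_iff, h.mem_ker_iff, Prod.fst_sub, sub_eq_zero]

/-- For a light-like frame, the symmetric product of `τ` and `n` is proportional to the inverse
metric. -/
theorem IsLightlikeFrame.symm_product {τ n : ℝ × ℝ} (h : IsLightlikeFrame τ n) :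
    n.1 * τ.1 + n.2 * τ.2 = 0 ∧ n.1 * τ.2 + n.2 * τ.1 = 0 := by
  obtain ⟨h1, h2, h3⟩ := h
  simp only [mink, area] at h1 h2 h3
  constructor
  · refine (mul_eq_zero.1 ?_).resolve_left h3
    linear_combination n.1 * n.2 * h1 - τ.1 * τ.2 * h2
  · refine (mul_eq_zero.1 ?_).resolve_left h3
    linear_combination n.2 * n.2 * h1 - τ.2 * τ.2 * h2

/-- Here the transversal direction is itself characteristic: `∂_τ φ` is constant along `n`, and
nothing else is constrained because the phase space forgets `φ_n`. -/
theorem IsLightlikeFrame.evolutionRelation_eq {η : ℝ} (hη : 0 < η) {τ n : ℝ × ℝ}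
    (h : IsLightlikeFrame τ n) {s₀ s₁ : ℝ} (hs : s₀ < s₁) :
    evolutionRelation η hη τ n s₀ s₁ = {z | z.1 = z.2} := by
  have hA := h.independent
  have hD := uniqueDiffOn_strip hA hs
  have m₀ := Set.left_mem_Icc.2 hs.le
  have m₁ := Set.right_mem_Icc.2 hs.le
  ext z
  constructor
  · rintro ⟨φ, hφ, hw, p₀, p₁, h₀, h₁, rfl⟩
    have hd := hφ.smooth.differentiableOn (by simp)
    refine (h.toPhase_eq_iff hη p₀ p₁).2 (Subtype.ext (eq_of_deriv_eq hη p₀.1.2 p₁.1.2 fun a => ?_))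
    have e : a • τ + s₀ • n + (s₁ - s₀) • n = a • τ + s₁ • n := by module
    have hc := fderivWithin_strip_eq_along hA hs hφ.smooth hw h.symm_product.1 h.symm_product.2
      (c := s₁ - s₀) (mem_strip τ n m₀ a) (by rw [e]; exact mem_strip τ n m₁ a)
    rw [e] at hc
    rw [h₁.deriv_fst m₁ hd, h₀.deriv_fst m₀ hd, hc]
  · obtain ⟨x, y⟩ := z
    intro hxy
    obtain rfl : x = y := hxy
    obtain ⟨p, rfl⟩ := toPhase_surjective η hη τ n x
    set ℓ := longitudinal τ n with hℓ
    obtain ⟨K, T, hK, hKT⟩ := one_add_norm_sq_le_of_mem_strip τ n s₀ s₁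
    have hw : IsWavePair η (p.1 : ℝ → ℝ) 0 := isWavePair_of_mem p.1.2 (decaySpace η).zero_mem
    have hn : ℓ n = 0 := by simpa using longitudinal_apply hA 0 1
    -- The covector `ℓ` annihilates the null vector `n`, hence is null.
    have hsq : ℓ (1, 0) ^ 2 = ℓ (0, 1) ^ 2 := by
      have hnn := h.normal
      rw [mink] at hnn
      simp only [hℓ, longitudinal, linForm_apply]
      linear_combination -(area τ n)⁻¹ ^ 2 * hnn
    have hb : ∀ s ∈ Set.Icc s₀ s₁, IsBoundaryValue (η := η) (strip τ n s₀ s₁) τ n s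
        (fun q => (p.1 : ℝ → ℝ) (ℓ q) + (0 : ℝ → ℝ) (ℓ q)) (p.1, 0) := fun s hs a => by
      rw [fderivWithin_superposition ℓ ℓ hD hw.left hw.right (mem_strip τ n hs a), hn]
      simp [hℓ, longitudinal_apply hA]
    refine ⟨_, isField_superposition ℓ ℓ hη hD hw hK (T := T) ?_,
      solvesWaveEquation_superposition ℓ ℓ hD hw.left hw.right hsq hsq, (p.1, 0), (p.1, 0),
      hb s₀ m₀, hb s₁ m₁, ?_⟩
    · rintro q ⟨a, s, hs', rfl⟩
      obtain ⟨h1, h2⟩ := hKT a s hs'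
      have h3 : |ℓ (a • τ + s • n) - a| ≤ T := by
        rw [hℓ, longitudinal_apply hA, sub_self, abs_zero]
        exact (abs_nonneg s).trans h1
      exact ⟨a, h3, h3, h2⟩
    -- The extension constant along `n` has `φ_n = 0`, which represents the same class as `p`.
    · rw [(h.toPhase_eq_iff hη p (p.1, 0)).2 rfl]

end MinkowskiStrip

end

/-! ### The non-null and the light-like case combined -/

theorem mainTheorem6 (η : ℝ) (hη : 0 < η) (τ n : ℝ × ℝ) (s₀ s₁ : ℝ) (hs : s₀ < s₁) :
    ((MinkowskiStrip.IsSpacelikeFrame τ n ∨ MinkowskiStrip.IsTimelikeFrame τ n) →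
      LinearMap.ker (MinkowskiStrip.preForm η hη τ n) = ⊥ ∧
      MinkowskiStrip.IsLagrangian (MinkowskiStrip.stripForm η hη τ n)
        (MinkowskiStrip.evolutionRelation η hη τ n s₀ s₁) ∧
      ∃ U : ℝ → MinkowskiStrip.PrePhase η → MinkowskiStrip.PrePhase η,
        MinkowskiStrip.IsHamiltonianFlow (MinkowskiStrip.preForm η hη τ n)
          MinkowskiStrip.hamiltonian U ∧
        ∀ p₀ p₁ : MinkowskiStrip.PrePhase η,
          ((MinkowskiStrip.toPhase η hη τ n p₀, MinkowskiStrip.toPhase η hη τ n p₁) ∈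
            MinkowskiStrip.evolutionRelation η hη τ n s₀ s₁ ↔ p₁ = U (s₁ - s₀) p₀)) ∧
    (MinkowskiStrip.IsLightlikeFrame τ n →
      (∀ p : MinkowskiStrip.PrePhase η,
        p ∈ LinearMap.ker (MinkowskiStrip.preForm η hη τ n) ↔ p.1 = 0) ∧
      MinkowskiStrip.IsLagrangian (MinkowskiStrip.stripForm η hη τ n)
        (MinkowskiStrip.evolutionRelation η hη τ n s₀ s₁) ∧
      MinkowskiStrip.evolutionRelation η hη τ n s₀ s₁ = {z | z.1 = z.2}) := by
  open MinkowskiStrip in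
  refine ⟨fun h => ?_, fun h => ⟨h.mem_ker_iff hη, ?_, h.evolutionRelation_eq hη hs⟩⟩
  · obtain ⟨hn, hτ⟩ := conjugate_of_frame h
    have hA : area τ n ≠ 0 := by
      intro h0
      apply hτ
      rw [hn, area] at h0
      linear_combination h0
    have hker := ker_preForm_of_conjugate hη hn hτ
    -- With trivial kernel, membership of classes in the relation is membership of the pairs
    -- themselves in the graph.
    have hinj : ∀ p q, toPhase η hη τ n p = toPhase η hη τ n q ↔ p = q := fun p q => by
      rw [toPhase_eq_iff, hker, Submodule.mem_bot, sub_eq_zero]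
    rw [evolutionRelation_of_conjugate hη hn hA hs]
    refine ⟨hker, isLagrangian_graph_waveFlow hη hn hτ _, waveFlow hη,
      isHamiltonianFlow_waveFlow hη hn hτ, fun p₀ p₁ => ?_⟩
    simp only [Set.mem_range, Prod.mk.injEq, hinj]
    constructor
    · rintro ⟨p, rfl, rfl⟩
      rfl
    · rintro rfl
      exact ⟨p₀, rfl, rfl⟩
  · rw [h.evolutionRelation_eq hη hs]
    exact isLagrangian_diagonal hη τ n
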